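/- Let $F$ be a germ of a holomorphic diffeomorphism of $(\mathbb C^2,0)$ and let $\Gamma$ be an irreducible formal curve at $0$ (a nonzero principal prime ideal of $\mathbb C[[x,y]]$) which is invariant by $F$, i.e. $h\circ F\in\Gamma$ for all $h\in\Gamma$. Assume that the pair $(F,\Gamma)$ is in reduced form in the coordinates $(x,y)$: there are integers $k\ge1$, $p\ge 0$, a number $\mu\in\mathbb C$, a polynomial $a$ of degree at most $p$ with $a(0)\ne0$ and a convergent series $b(x)$ such that $$x\circ F=x-x^{k+p+1}+O(x^{k+p+1}y,\,x^{2k+2p+1}),\qquad y\circ F=\mu\left[y+x^ka(x)y+O(x^{k+p+1}y)+b(x)\right],$$ where $O(g_1,\dots)$ denotes an element of the ideal generated by $g_1,\dots$ in the ring of germs of holomorphic functions, and $\Gamma$ is non-singular with a parametrization $\gamma(s)=(s,\gamma_2(s))$ with $\gamma_2\in\mathbb C[[s]]$ of order at least $k+p+2$ (that is, $h\in\Gamma$ if and only if $h(\gamma(s))=0$). Let $J_l$ denote the jet of order $l$ (terms of degree at most $l$), and let $A_0,\dots,A_p$ be defined by $$\log\mu+x^k(A_0+A_1x+\dots+A_px^p)=J_{k+p}\bigl(\log(\mu(1+x^ka(x)))\bigr).$$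 Let $\ell=\xi\mathbb R^+$, with $\xi^{k+p}=1$, be an attracting direction which is a node direction, i.e. such that $$\left(\ln|\mu|,\operatorname{Re}(\xi^kA_0),\dots,\operatorname{Re}(\xi^{k+p-1}A_{p-1})\right)<0$$ in the lexicographic order. A non-trivial stable orbit of $F$ in $U$ is a sequence $z_n\in U\setminus\{0\}$ with $z_{n+1}=F(z_n)$ for all $n\ge0$ and $z_n\to0$. It is asymptotic to $\Gamma$ if its set of points $O$ has the infinitely near points of $\Gamma$ as iterated tangents: blowing up the origin, the closure of the inverse image of $O$ meets the exceptional divisor in exactly one point, which is the first infinitely near point of $\Gamma$; blowing up this point, the closure of the inverse image of $O$ meets the new exceptional divisor in exactly one point, which is the second infinitely near point of $\Gamma$; and so on. Then, for every open neighbourhood $U$ of $0$ on which $F$ is defined and holomorphic, there exist a connected and simply connected open set $R\subset\mathbb C$, with $0\in\partial R$, that contains the germ of $\ell$ at $0$ (i.e. $t\xi\in R$ for all sufficiently small $t>0$), and integers $M\ge k+p+2$ and $q\ge p+1$ such that the set $$S=\left\{(x,y): x\in R,\ |y-J_M\gamma_2(x)|<|x|^q\right\}$$ is an open stable manifold of $F$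 in $U$ (that is, $S$ is open, $S\subset U$, $F(S)\subset S$, and $F^n(z)\to0$ for every $z\in S$), and the orbit of every point of $S$ is a non-trivial stable orbit asymptotic to $\Gamma$. Moreover, if $\{(x_n,y_n)\}$ is a non-trivial stable orbit of $F$ in $U$ asymptotic to $\Gamma$ such that $\{x_n\}$ has $\ell$ as tangent direction (i.e. $x_n\to0$, $x_n\neq0$ for $n$ large and $x_n/|x_n|\to\xi$), then $(x_n,y_n)\in S$ for all $n$ sufficiently big. -/

import Mathlib

open Filter Topology

noncomputable section

/-- A germ of holomorphic diffeomorphism of `(ℂ², 0)`, given by a representative. -/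
structure IsGermDiffeo (F : ℂ × ℂ → ℂ × ℂ) : Prop where
  map_zero : F 0 = 0
  analyticAt : AnalyticAt ℂ F 0
  bijective_fderiv : Function.Bijective (fderiv ℂ F 0)

/-- An irreducible formal curve at `0 ∈ ℂ²`: a non-zero principal prime ideal of `ℂ[[x, y]]`;
the variable `x` has index `0` and `y` has index `1`. -/
structure FormalCurve where
  ideal : Ideal (MvPowerSeries (Fin 2) ℂ)
  isPrime : ideal.IsPrime
  isPrincipal : ideal.IsPrincipal
  ne_bot : ideal ≠ ⊥

/-- The Taylor series at the origin of a function of two complex variables: the coefficient of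
`x ^ i * y ^ j` is `∂ₓⁱ ∂ᵧʲ f (0, 0) / (i! j!)`. -/
def taylorSeries (f : ℂ × ℂ → ℂ) : MvPowerSeries (Fin 2) ℂ := fun n =>
  iteratedDeriv (n 0) (fun x => iteratedDeriv (n 1) (fun y => f (x, y)) 0) 0 /
    ((n 0).factorial * (n 1).factorial)

/-- The formal composition `h ∘ F`. -/
def formalComp (h : MvPowerSeries (Fin 2) ℂ) (F : ℂ × ℂ → ℂ × ℂ) : MvPowerSeries (Fin 2) ℂ :=
  MvPowerSeries.subst
    ![taylorSeries (fun z => (F z).1), taylorSeries (fun z => (F z).2)] h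

/-! ### Blow-ups -/

/-- The point `[x : y]` of the projective line `ℙ¹(ℂ) = ℂ ∪ {∞}`, written as the slope `y / x`. -/
def projSlope (z : ℂ × ℂ) : OnePoint ℂ :=
  if z.1 = 0 then OnePoint.infty else OnePoint.some (z.2 / z.1)

/-- Off its exceptional divisor `{0} × ℙ¹(ℂ)`, the blow-up of `ℂ²` at the origin is the set of
the points `(z, projSlope z)` of `ℂ² × ℙ¹(ℂ)`. For a set `S` that does not contain the origin,
`tangents S` is the intersection of the exceptional divisor with the closure of the inverse
image of `S` in the blow-up. -/
def tangents (S : Set (ℂ × ℂ)) : Set (OnePoint ℂ) :=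
  {c | ((0 : ℂ × ℂ), c) ∈ closure ((fun z => (z, projSlope z)) '' S)}

/-- The blow-down map in the affine chart of the blow-up centred at the point `c` of the
exceptional divisor: `(x, y) ↦ (x, x (y + t))` if `c` is the slope `t ∈ ℂ`, and
`(x, y) ↦ (x y, y)` if `c = ∞`. It is applied to points of `ℂ²` and to pairs of power series. -/
def blowDown {A : Type*} [CommRing A] [Algebra ℂ A] : OnePoint ℂ → A × A → A × A
  | OnePoint.infty, w => (w.1 * w.2, w.2)
  | OnePoint.some t, w => (w.1, w.1 * (w.2 + algebraMap ℂ A t))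

/-- The inverse image of `S` under the composition of the first `n` blow-ups centred at the
points `q 0, …, q (n - 1)`, read in the chart centred at the last of these points. -/
def liftedSet (q : ℕ → OnePoint ℂ) (S : Set (ℂ × ℂ)) : ℕ → Set (ℂ × ℂ)
  | 0 => S
  | n + 1 => blowDown (q n) ⁻¹' liftedSet q S n

/-- `S` has the property of iterated tangents, with sequence of iterated tangents `q`; here
`q n` is the point obtained by the `(n + 1)`-st blow-up. -/
def HasIteratedTangents (S : Set (ℂ × ℂ)) (q : ℕ → OnePoint ℂ) : Prop :=
  ∀ n, tangents (liftedSet q S n) = {q n}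

namespace FormalCurve

/-- `Γ` is invariant by `F`. -/
def IsInvariant (Γ : FormalCurve) (F : ℂ × ℂ → ℂ × ℂ) : Prop :=
  ∀ h ∈ Γ.ideal, formalComp h F ∈ Γ.ideal

/-- `γ` is a parametrization of `Γ`: `γ ≠ 0`, `γ(0) = 0`, and `h ∈ Γ` if and only if
`h(γ(s)) = 0`. -/
structure IsParametrization (Γ : FormalCurve) (γ : PowerSeries ℂ × PowerSeries ℂ) : Prop where
  ne_zero : γ ≠ 0
  constantCoeff_fst : PowerSeries.constantCoeff γ.1 = 0
  constantCoeff_snd : PowerSeries.constantCoeff γ.2 = 0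
  mem_iff : ∀ h : MvPowerSeries (Fin 2) ℂ, h ∈ Γ.ideal ↔
    MvPowerSeries.subst (![γ.1, γ.2] : Fin 2 → MvPowerSeries Unit ℂ) h = 0

/-- `q` is the sequence of infinitely near points of `Γ`: a parametrization of `Γ` lifts
successively to parametrizations (of the strict transforms of `Γ`) through the points
`q 0`, `q 1`, …, each of them being taken as the origin of its chart. -/
def IsInfinitelyNear (Γ : FormalCurve) (q : ℕ → OnePoint ℂ) : Prop :=
  ∃ G : ℕ → PowerSeries ℂ × PowerSeries ℂ, Γ.IsParametrization (G 0) ∧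
    ∀ n, blowDown (q n) (G (n + 1)) = G n ∧
      PowerSeries.constantCoeff (G (n + 1)).1 = 0 ∧
      PowerSeries.constantCoeff (G (n + 1)).2 = 0

/-- The set `S` is asymptotic to `Γ`: it has iterated tangents, and these are the infinitely
near points of `Γ`. -/
def IsAsymptotic (Γ : FormalCurve) (S : Set (ℂ × ℂ)) : Prop :=
  ∃ q, Γ.IsInfinitelyNear q ∧ HasIteratedTangents S q

end FormalCurve

/-! ### Stable sets and orbits -/

/-- `S` is a stable set of `F` in `U`. -/
structure IsStableSet (F : ℂ × ℂ → ℂ × ℂ) (U S : Set (ℂ × ℂ)) : Prop where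
  subset : S ⊆ U
  mapsTo : Set.MapsTo F S S
  tendsto : ∀ z ∈ S, Tendsto (fun n => F^[n] z) atTop (𝓝 0)

/-- `S` is an open stable manifold of `F` in `U`. -/
structure IsOpenStableManifold (F : ℂ × ℂ → ℂ × ℂ) (U S : Set (ℂ × ℂ)) : Prop
    extends IsStableSet F U S where
  isOpen : IsOpen S

/-- `z` is a non-trivial stable orbit of `F` in `U` which is asymptotic to `Γ`. -/
structure IsAsymptoticOrbit (F : ℂ × ℂ → ℂ × ℂ) (U : Set (ℂ × ℂ)) (Γ : FormalCurve)
    (z : ℕ → ℂ × ℂ) : Prop where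
  mem : ∀ n, z n ∈ U
  ne_zero : ∀ n, z n ≠ 0
  step : ∀ n, z (n + 1) = F (z n)
  tendsto : Tendsto z atTop (𝓝 0)
  asymptotic : Γ.IsAsymptotic (Set.range z)

/-- The sequence `x` of complex numbers has the half-line `ξ ℝ⁺` (where `|ξ| = 1`) as tangent
direction at the origin. -/
def HasTangentDirection (x : ℕ → ℂ) (ξ : ℂ) : Prop :=
  Tendsto x atTop (𝓝 0) ∧ (∀ᶠ n in atTop, x n ≠ 0) ∧
    Tendsto (fun n => x n / (‖x n‖ : ℂ)) atTop (𝓝 ξ)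

/-! ### Reduced pairs -/

/-- The pair `(F, Γ)` is in reduced form in the coordinates `(x, y)` of `ℂ²`:
`x ∘ F = x - x^(k+p+1) + O(x^(k+p+1) y, x^(2k+2p+1))` and
`y ∘ F = μ (y + x^k a(x) y + O(x^(k+p+1) y) + b(x))`, where `O(g₁, …)` denotes an element of the
ideal generated by `g₁, …` in the ring of germs of holomorphic functions, and `Γ` is
non-singular with order of contact at least `k + p + 2` with the `x`-axis, that is, it has a
parametrization `(s, γ₂(s))` with `γ₂` of order at least `k + p + 2`. -/
structure IsReducedForm (F : ℂ × ℂ → ℂ × ℂ) (Γ : FormalCurve) (k p : ℕ) (μ : ℂ)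
    (a : Polynomial ℂ) : Prop where
  one_le : 1 ≤ k
  natDegree_le : a.natDegree ≤ p
  eval_zero_ne : a.eval 0 ≠ 0
  fst_eq : ∃ A B : ℂ × ℂ → ℂ, AnalyticAt ℂ A 0 ∧ AnalyticAt ℂ B 0 ∧
    ∀ᶠ z : ℂ × ℂ in 𝓝 0, (F z).1 =
      z.1 - z.1 ^ (k + p + 1) + z.1 ^ (k + p + 1) * z.2 * A z + z.1 ^ (2 * k + 2 * p + 1) * B z
  snd_eq : ∃ (C : ℂ × ℂ → ℂ) (b : ℂ → ℂ), AnalyticAt ℂ C 0 ∧ AnalyticAt ℂ b 0 ∧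
    ∀ᶠ z : ℂ × ℂ in 𝓝 0, (F z).2 =
      μ * (z.2 + z.1 ^ k * a.eval z.1 * z.2 + z.1 ^ (k + p + 1) * z.2 * C z + b z.1)
  contact : ∃ γ₂ : PowerSeries ℂ, Γ.IsParametrization (PowerSeries.X, γ₂) ∧
    ((k + p + 2 : ℕ) : ℕ∞) ≤ γ₂.order

/-- The coefficient `A_j` of the infinitesimal principal part
`log μ + x^k (A_0 + A_1 x + ⋯ + A_p x^p) = J_{k+p} (log (μ (1 + x^k a(x))))`: the Taylor
coefficient of degree `k + j` of `log (1 + x^k a(x))` at `0`. -/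
def infinitesimalCoeff (k : ℕ) (a : Polynomial ℂ) (j : ℕ) : ℂ :=
  iteratedDeriv (k + j) (fun x : ℂ => Complex.log (1 + x ^ k * a.eval x)) 0 /
    (k + j).factorial

/-- The attracting direction `ξ ℝ⁺` is a node direction:
`(ln |μ|, Re (ξ^k A_0), …, Re (ξ^(k+p-1) A_(p-1))) < 0` in the lexicographic order. -/
def IsNodeDirection (k p : ℕ) (μ : ℂ) (a : Polynomial ℂ) (ξ : ℂ) : Prop :=
  toLex (Fin.cons (Real.log ‖μ‖)
    (fun j : Fin p => (ξ ^ (k + (j : ℕ)) * infinitesimalCoeff k a j).re) : Fin (p + 1) → ℝ) <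
  toLex (0 : Fin (p + 1) → ℝ)

/-- The set of the `(x, y)` with `x ∈ R` and `|y - J_M γ₂(x)| < |x|^q`, where `J_M γ₂` is the
jet of `γ₂` of order `M` (terms of degree at most `M`). -/
def nodeDomain (R : Set ℂ) (γ₂ : PowerSeries ℂ) (M q : ℕ) : Set (ℂ × ℂ) :=
  {z | z.1 ∈ R ∧ ‖z.2 - (PowerSeries.trunc (M + 1) γ₂).eval z.1‖ < ‖z.1‖ ^ q}

end

/-! Write r = k + p. The proof combines a one-dimensional parabolic estimate in `x` with a
contraction in the transverse direction.

In the Fatou coordinate Z = 1/(r x^r), and where |y| ≤ |x|^r, the first component is Z ↦ Z + 1 +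
O(1/Re Z) (`fatou_step`, `IsReducedForm.fatou_bound`). The errors in Im Z add up like C·Σ 1/n, hence
logarithmically. A region |Im Z| < B log Re Z, Re Z > K, with B large compared with C, is therefore
invariant (`petal_step`), and it absorbs every orbit with Re Z → ∞ (`eventually_mem_logRegion`), in
particular those tangent to ξ. It is also thin: on it x deviates from the ray by at most |x|^(p+1)
(`petal_small`). This matters because the node condition controls real parts only on the ray itself;
this closeness is what transfers them to |μ(1 + x^k a(x))| ≤ 1 - c|x|^(r-1) (`node_bound`).

Transversally, invariance of the formal curve says that the graph of a jet J of γ₂ is invariant up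
to a high power of x (`FormalCurve.IsInvariant.isBigO`). The height y - J(x) is thus multiplied by
at most 1 - c|x|^(r-1) up to smaller errors, whereas the width |x|^q shrinks in one step only by 1 -
O(|x|^r). So the set |y - J(x)| < W|x|^q is preserved near 0, for every W ≥ 1 (`transverse_step`).
With W = 1 this gives the stable manifold; with arbitrary q and W depending on the orbit it gives
flat contact with Γ (`tendsto_contact`).

Finally, the infinitely near points of the graph of γ₂ are its successive coefficients, so for
sequences tending to 0 with x ≠ 0, being asymptotic to Γ amounts to flat contact
(`FormalCurve.IsParametrization.isAsymptotic`,
`FormalCurve.IsParametrization.contact_of_isAsymptotic`). -/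

noncomputable section

/-! ### Formal invariance of the curve and its jets -/

section Formal

variable {τ : Type*}

/-- The series `y - g(x)`, which defines the graph of `g`. -/
def graphSeries (g : PowerSeries ℂ) : MvPowerSeries (Fin 2) ℂ :=
  MvPowerSeries.X 1 - PowerSeries.subst (MvPowerSeries.X 0 : MvPowerSeries (Fin 2) ℂ) g

lemma hasSubst_pair {u v : MvPowerSeries τ ℂ} (hu : MvPowerSeries.constantCoeff u = 0)
    (hv : MvPowerSeries.constantCoeff v = 0) :
    MvPowerSeries.HasSubst (![u, v] : Fin 2 → MvPowerSeries τ ℂ) := by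
  apply MvPowerSeries.hasSubst_of_constantCoeff_zero
  intro s
  fin_cases s
  · exact hu
  · exact hv

lemma subst_graphSeries {u v : MvPowerSeries τ ℂ} (hu : MvPowerSeries.constantCoeff u = 0)
    (hv : MvPowerSeries.constantCoeff v = 0) (g : PowerSeries ℂ) :
    MvPowerSeries.subst (![u, v] : Fin 2 → MvPowerSeries τ ℂ) (graphSeries g) =
      v - PowerSeries.subst u g := by
  have h := hasSubst_pair hu hv
  rw [graphSeries, MvPowerSeries.subst_sub h, MvPowerSeries.subst_X h]
  congr 1
  rw [PowerSeries.subst, PowerSeries.subst,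
    MvPowerSeries.subst_comp_subst_apply (PowerSeries.HasSubst.X 0).const h]
  simp [MvPowerSeries.subst_X h]

lemma FormalCurve.IsParametrization.graphSeries_mem {Γ : FormalCurve} {g : PowerSeries ℂ}
    (h : Γ.IsParametrization (PowerSeries.X, g)) : graphSeries g ∈ Γ.ideal := by
  rw [h.mem_iff]
  change MvPowerSeries.subst (![PowerSeries.X, g] : Fin 2 → MvPowerSeries Unit ℂ) _ = 0
  rw [subst_graphSeries (u := (PowerSeries.X : PowerSeries ℂ)) (v := g)
    PowerSeries.constantCoeff_X h.constantCoeff_snd]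
  rw [sub_eq_zero]
  exact (PowerSeries.X_subst g).symm

/-- Every parametrization annihilates y - g(x), so it is a reparametrization of (s, g(s)). This
yields the uniqueness of γ₂ and, later, of the infinitely near points. -/
lemma FormalCurve.IsParametrization.snd_eq_subst {Γ : FormalCurve} {g : PowerSeries ℂ}
    {G : PowerSeries ℂ × PowerSeries ℂ} (h : Γ.IsParametrization (PowerSeries.X, g))
    (hG : Γ.IsParametrization G) : G.2 = PowerSeries.subst G.1 g := by
  have := (hG.mem_iff _).1 h.graphSeries_mem
  rw [subst_graphSeries (u := G.1) (v := G.2) hG.constantCoeff_fst hG.constantCoeff_snd] at this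
  exact sub_eq_zero.1 this

lemma FormalCurve.IsParametrization.snd_unique {Γ : FormalCurve} {g g' : PowerSeries ℂ}
    (h : Γ.IsParametrization (PowerSeries.X, g)) (h' : Γ.IsParametrization (PowerSeries.X, g')) :
    g' = g := by
  exact (h.snd_eq_subst h').trans (PowerSeries.X_subst g)

lemma FormalCurve.IsParametrization.coeff_trunc {Γ : FormalCurve} {g : PowerSeries ℂ}
    (h : Γ.IsParametrization (PowerSeries.X, g)) (n : ℕ) : (PowerSeries.trunc n g).coeff 0 = 0 := by
  have : PowerSeries.constantCoeff g = 0 := h.constantCoeff_snd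
  rw [PowerSeries.coeff_trunc, PowerSeries.coeff_zero_eq_constantCoeff_apply, this, ite_self]

lemma FormalCurve.IsParametrization.eval_trunc {Γ : FormalCurve} {g : PowerSeries ℂ}
    (h : Γ.IsParametrization (PowerSeries.X, g)) (n : ℕ) : (PowerSeries.trunc n g).eval 0 = 0 := by
  rw [← Polynomial.coeff_zero_eq_eval_zero, h.coeff_trunc]

lemma constantCoeff_subst_pair {u v : PowerSeries ℂ} (hu : PowerSeries.constantCoeff u = 0)
    (hv : PowerSeries.constantCoeff v = 0) {T : MvPowerSeries (Fin 2) ℂ}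
    (hT : MvPowerSeries.constantCoeff T = 0) :
    PowerSeries.constantCoeff (R := ℂ)
      (MvPowerSeries.subst (![u, v] : Fin 2 → MvPowerSeries Unit ℂ) T) = 0 := by
  apply MvPowerSeries.constantCoeff_subst_eq_zero (hasSubst_pair hu hv) _ hT
  intro i
  fin_cases i
  · exact hu
  · exact hv

/-- Invariance is applied to the single element y - g(x) and the result is restricted to the curve.
-/
lemma FormalCurve.IsInvariant.subst_eq {Γ : FormalCurve} {g : PowerSeries ℂ}
    {F : ℂ × ℂ → ℂ × ℂ} (hΓ : Γ.IsInvariant F) (h : Γ.IsParametrization (PowerSeries.X, g))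
    (h1 : MvPowerSeries.constantCoeff (taylorSeries fun z => (F z).1) = 0)
    (h2 : MvPowerSeries.constantCoeff (taylorSeries fun z => (F z).2) = 0) :
    (MvPowerSeries.subst (![PowerSeries.X, g] : Fin 2 → MvPowerSeries Unit ℂ)
      (taylorSeries fun z => (F z).2) : PowerSeries ℂ) =
    PowerSeries.subst (MvPowerSeries.subst (![PowerSeries.X, g] : Fin 2 → MvPowerSeries Unit ℂ)
      (taylorSeries fun z => (F z).1) : PowerSeries ℂ) g := by
  have hX : PowerSeries.constantCoeff (PowerSeries.X : PowerSeries ℂ) = 0 :=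
    PowerSeries.constantCoeff_X
  have hs := hasSubst_pair (u := (PowerSeries.X : PowerSeries ℂ)) (v := g) hX h.constantCoeff_snd
  have := (h.mem_iff _).1 (hΓ _ h.graphSeries_mem)
  rw [formalComp, MvPowerSeries.subst_comp_subst_apply (hasSubst_pair h1 h2) hs] at this
  have e : (fun s => MvPowerSeries.subst (![PowerSeries.X, g] : Fin 2 → MvPowerSeries Unit ℂ)
      ((![taylorSeries fun z => (F z).1, taylorSeries fun z => (F z).2] :
        Fin 2 → MvPowerSeries (Fin 2) ℂ) s)) =
      ![MvPowerSeries.subst (![PowerSeries.X, g] : Fin 2 → MvPowerSeries Unit ℂ)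
        (taylorSeries fun z => (F z).1),
        MvPowerSeries.subst (![PowerSeries.X, g] : Fin 2 → MvPowerSeries Unit ℂ)
        (taylorSeries fun z => (F z).2)] := by
    funext s
    fin_cases s <;> rfl
  rw [e, subst_graphSeries (constantCoeff_subst_pair hX h.constantCoeff_snd h1)
    (constantCoeff_subst_pair hX h.constantCoeff_snd h2)] at this
  exact sub_eq_zero.1 this

/-- The coefficient of `x ^ i * y ^ j`. -/
def coeffPair (T : MvPowerSeries (Fin 2) ℂ) (i j : ℕ) : ℂ :=
  MvPowerSeries.coeff (Finsupp.single 0 i + Finsupp.single 1 j) T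

lemma eq_single_add_single (e : Fin 2 →₀ ℕ) (i j : ℕ) :
    e = Finsupp.single 0 i + Finsupp.single 1 j ↔ i = e 0 ∧ j = e 1 := by
  constructor
  · rintro rfl
    simp
  · rintro ⟨rfl, rfl⟩
    ext s
    fin_cases s <;> simp

/-- The polynomial `∑_{i, j < n} c_{i j} X ^ i * J ^ j`, where the `c_{i j}` are the coefficients
of `T`. -/
def truncAlong (T : MvPowerSeries (Fin 2) ℂ) (n : ℕ) (J : Polynomial ℂ) : Polynomial ℂ :=
  ∑ i ∈ Finset.range n, ∑ j ∈ Finset.range n,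
    Polynomial.C (coeffPair T i j) * (Polynomial.X ^ i * J ^ j)

/-- Both remainders become divisible by X ^ n after substituting series without constant term, which
reduces formal substitution modulo X ^ n to polynomials. -/
lemma exists_decomposition (T : MvPowerSeries (Fin 2) ℂ) (n : ℕ) :
    ∃ A B : MvPowerSeries (Fin 2) ℂ,
      T = (∑ i ∈ Finset.range n, ∑ j ∈ Finset.range n, MvPowerSeries.monomial
        (Finsupp.single 0 i + Finsupp.single 1 j) (coeffPair T i j)) +
        MvPowerSeries.X 0 ^ n * A + MvPowerSeries.X 1 ^ n * B := by
  classical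
  let a : MvPowerSeries (Fin 2) ℂ := fun e => if n ≤ e 0 then MvPowerSeries.coeff e T else 0
  -- The condition `e 0 < n` avoids counting twice the monomials divisible by both x^n and y^n.
  let b : MvPowerSeries (Fin 2) ℂ := fun e =>
    if e 0 < n ∧ n ≤ e 1 then MvPowerSeries.coeff e T else 0
  have ca : ∀ e, MvPowerSeries.coeff e a = if n ≤ e 0 then MvPowerSeries.coeff e T else 0 :=
    fun e => rfl
  have cb : ∀ e, MvPowerSeries.coeff e b =
      if e 0 < n ∧ n ≤ e 1 then MvPowerSeries.coeff e T else 0 := fun e => rfl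
  obtain ⟨A, hA⟩ : (MvPowerSeries.X 0 : MvPowerSeries (Fin 2) ℂ) ^ n ∣ a := by
    rw [MvPowerSeries.X_pow_dvd_iff]
    intro m hm
    rw [ca, if_neg (by omega)]
  obtain ⟨B, hB⟩ : (MvPowerSeries.X 1 : MvPowerSeries (Fin 2) ℂ) ^ n ∣ b := by
    rw [MvPowerSeries.X_pow_dvd_iff]
    intro m hm
    rw [cb, if_neg (by omega)]
  refine ⟨A, B, ?_⟩
  rw [← hA, ← hB]
  ext e
  have key : MvPowerSeries.coeff e (∑ i ∈ Finset.range n, ∑ j ∈ Finset.range n,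
      MvPowerSeries.monomial (Finsupp.single 0 i + Finsupp.single 1 j) (coeffPair T i j)) =
      if e 0 < n ∧ e 1 < n then MvPowerSeries.coeff e T else 0 := by
    simp only [map_sum, MvPowerSeries.coeff_monomial, eq_single_add_single, ite_and]
    rw [Finset.sum_eq_ite (e 0)]
    · simp only [Finset.mem_range, if_true]
      rw [Finset.sum_ite_eq']
      simp only [Finset.mem_range, coeffPair]
      rw [← (eq_single_add_single e (e 0) (e 1)).2 ⟨rfl, rfl⟩]
    · intro i _ hi
      simp [hi]
  rw [map_add, map_add, key, ca, cb]
  by_cases h0 : e 0 < n <;> by_cases h1 : e 1 < n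
  · simp [h0, h1, not_le.2 h0, not_le.2 h1]
  · simp [h0, h1, not_le.2 h0, not_lt.1 h1]
  · simp [h0, not_lt.1 h0]
  · simp [h0, not_lt.1 h0]

lemma X_pow_dvd_sub_trunc (g : PowerSeries ℂ) (n : ℕ) :
    (PowerSeries.X : PowerSeries ℂ) ^ n ∣ g - (PowerSeries.trunc n g : Polynomial ℂ) := by
  rw [PowerSeries.X_pow_dvd_iff]
  intro m hm
  rw [map_sub, Polynomial.coeff_coe, PowerSeries.coeff_trunc, if_pos hm, sub_self]

lemma dvd_pow_sub_pow_of_dvd {R : Type*} [CommRing R] {d a b : R} (h : d ∣ a - b) (n : ℕ) :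
    d ∣ a ^ n - b ^ n :=
  h.trans (sub_dvd_pow_sub_pow a b n)

lemma X_pow_dvd_subst_sub_truncAlong (T : MvPowerSeries (Fin 2) ℂ) (n : ℕ) (g : PowerSeries ℂ)
    (hg : PowerSeries.constantCoeff g = 0) (J : Polynomial ℂ)
    (hJ : (PowerSeries.X : PowerSeries ℂ) ^ n ∣ g - J) :
    (PowerSeries.X : PowerSeries ℂ) ^ n ∣
      (MvPowerSeries.subst (![PowerSeries.X, g] : Fin 2 → MvPowerSeries Unit ℂ) T :
        PowerSeries ℂ) - (truncAlong T n J : Polynomial ℂ) := by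
  have hX : PowerSeries.constantCoeff (PowerSeries.X : PowerSeries ℂ) = 0 :=
    PowerSeries.constantCoeff_X
  have hs := hasSubst_pair (u := (PowerSeries.X : PowerSeries ℂ)) (v := g) hX hg
  obtain ⟨A, B, hAB⟩ := exists_decomposition T n
  have hgX : (PowerSeries.X : PowerSeries ℂ) ^ n ∣ g ^ n :=
    pow_dvd_pow_of_dvd (PowerSeries.X_dvd_iff.2 hg) n
  have e : (MvPowerSeries.subst (![PowerSeries.X, g] : Fin 2 → MvPowerSeries Unit ℂ) T :
        PowerSeries ℂ) = (∑ i ∈ Finset.range n, ∑ j ∈ Finset.range n,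
          PowerSeries.C (coeffPair T i j) * ((PowerSeries.X : PowerSeries ℂ) ^ i * g ^ j)) +
        (PowerSeries.X : PowerSeries ℂ) ^ n *
          (MvPowerSeries.subst (![PowerSeries.X, g] : Fin 2 → MvPowerSeries Unit ℂ) A :
            PowerSeries ℂ) +
        g ^ n * (MvPowerSeries.subst (![PowerSeries.X, g] : Fin 2 → MvPowerSeries Unit ℂ) B :
            PowerSeries ℂ) := by
    conv_lhs => rw [hAB]
    rw [MvPowerSeries.subst_add hs, MvPowerSeries.subst_add hs, MvPowerSeries.subst_mul hs,
      MvPowerSeries.subst_mul hs, MvPowerSeries.subst_pow hs, MvPowerSeries.subst_pow hs,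
      MvPowerSeries.subst_X hs, MvPowerSeries.subst_X hs]
    congr 2
    rw [← MvPowerSeries.coe_substAlgHom hs, map_sum]
    refine Finset.sum_congr rfl fun i _ => ?_
    rw [map_sum]
    refine Finset.sum_congr rfl fun j _ => ?_
    rw [MvPowerSeries.substAlgHom_monomial, Finsupp.prod_add_index' (by simp)
      (by intros; rw [pow_add]), Finsupp.prod_single_index (by simp),
      Finsupp.prod_single_index (by simp)]
    rfl
  rw [e, truncAlong]
  have e2 : ((∑ i ∈ Finset.range n, ∑ j ∈ Finset.range n,
      Polynomial.C (coeffPair T i j) * (Polynomial.X ^ i * J ^ j) : Polynomial ℂ) :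
        PowerSeries ℂ) = ∑ i ∈ Finset.range n, ∑ j ∈ Finset.range n,
      PowerSeries.C (coeffPair T i j) * ((PowerSeries.X : PowerSeries ℂ) ^ i *
        (J : PowerSeries ℂ) ^ j) := by
    rw [← Polynomial.coeToPowerSeries.ringHom_apply]
    simp only [map_sum, map_mul, map_pow, Polynomial.coeToPowerSeries.ringHom_apply,
      Polynomial.coe_C, Polynomial.coe_X]
  rw [e2]
  have e3 : ∀ (s t u v : PowerSeries ℂ), s + u + v - t = (s - t) + (u + v) := by
    intros; ring
  rw [e3]
  refine dvd_add ?_ (dvd_add (dvd_mul_right _ _) (hgX.mul_right _))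
  rw [← Finset.sum_sub_distrib]
  refine Finset.dvd_sum fun i _ => ?_
  rw [← Finset.sum_sub_distrib]
  refine Finset.dvd_sum fun j _ => ?_
  rw [← mul_sub, ← mul_sub]
  exact ((dvd_pow_sub_pow_of_dvd hJ j).mul_left _).mul_left _

lemma dvd_aeval_sub_aeval_of_dvd (J : Polynomial ℂ) {d a b : PowerSeries ℂ} (h : d ∣ a - b) :
    d ∣ Polynomial.aeval a J - Polynomial.aeval b J :=
  h.trans (by
    rw [Polynomial.aeval_def, Polynomial.aeval_def, Polynomial.eval₂_eq_eval_map,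
      Polynomial.eval₂_eq_eval_map]
    exact Polynomial.sub_dvd_eval_sub a b _)

lemma coe_comp_eq_aeval (J Q : Polynomial ℂ) :
    ((J.comp Q : Polynomial ℂ) : PowerSeries ℂ) = Polynomial.aeval (Q : PowerSeries ℂ) J := by
  rw [Polynomial.comp, Polynomial.aeval_def, ← Polynomial.coeToPowerSeries.ringHom_apply,
    Polynomial.hom_eval₂]
  congr 1
  ext c
  simp [Polynomial.coeToPowerSeries.ringHom_apply]

/-- Invariance of the graph of `g`, truncated: with `J` the jet of `g` of order less than `n`,
`F₂(x, J(x)) - J(F₁(x, J(x)))` vanishes to order `n` on the level of jets. -/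
lemma FormalCurve.IsInvariant.X_pow_dvd {Γ : FormalCurve} {g : PowerSeries ℂ}
    {F : ℂ × ℂ → ℂ × ℂ} (hΓ : Γ.IsInvariant F) (h : Γ.IsParametrization (PowerSeries.X, g))
    (h1 : MvPowerSeries.constantCoeff (taylorSeries fun z => (F z).1) = 0)
    (h2 : MvPowerSeries.constantCoeff (taylorSeries fun z => (F z).2) = 0) (n : ℕ) :
    (Polynomial.X : Polynomial ℂ) ^ n ∣
      truncAlong (taylorSeries fun z => (F z).2) n (PowerSeries.trunc n g) -
      (PowerSeries.trunc n g).comp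
        (truncAlong (taylorSeries fun z => (F z).1) n (PowerSeries.trunc n g)) := by
  set J := PowerSeries.trunc n g with hJ
  have hX : PowerSeries.constantCoeff (PowerSeries.X : PowerSeries ℂ) = 0 :=
    PowerSeries.constantCoeff_X
  have hJg := X_pow_dvd_sub_trunc g n
  have d1 := X_pow_dvd_subst_sub_truncAlong (taylorSeries fun z => (F z).1) n g
    h.constantCoeff_snd J hJg
  have d2 := X_pow_dvd_subst_sub_truncAlong (taylorSeries fun z => (F z).2) n g
    h.constantCoeff_snd J hJg
  have c1 := constantCoeff_subst_pair hX h.constantCoeff_snd h1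
  have inv := hΓ.subst_eq h h1 h2
  set f1 : PowerSeries ℂ := MvPowerSeries.subst
    (![PowerSeries.X, g] : Fin 2 → MvPowerSeries Unit ℂ) (taylorSeries fun z => (F z).1) with hf1
  have hs : PowerSeries.HasSubst f1 := PowerSeries.HasSubst.of_constantCoeff_zero' c1
  obtain ⟨g', hg'⟩ := hJg
  -- As g = J + X^n g' and `f1` has no constant term, replacing g by its jet in g ∘ f1 costs only a
  -- multiple of f1^n, hence of X^n.
  have e : PowerSeries.subst f1 g = Polynomial.aeval f1 J + f1 ^ n * PowerSeries.subst f1 g' := by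
    rw [← sub_eq_iff_eq_add', ← PowerSeries.subst_coe hs, ← PowerSeries.subst_sub hs, hg',
      PowerSeries.subst_mul hs, PowerSeries.subst_pow hs, PowerSeries.subst_X hs]
  have d3 : (PowerSeries.X : PowerSeries ℂ) ^ n ∣
      ((truncAlong (taylorSeries fun z => (F z).2) n J - J.comp
        (truncAlong (taylorSeries fun z => (F z).1) n J) : Polynomial ℂ) : PowerSeries ℂ) := by
    rw [inv, e] at d2
    have d4 := dvd_aeval_sub_aeval_of_dvd J d1
    have d5 : (PowerSeries.X : PowerSeries ℂ) ^ n ∣ f1 ^ n * PowerSeries.subst f1 g' :=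
      (pow_dvd_pow_of_dvd (PowerSeries.X_dvd_iff.2 c1) n).mul_right _
    rw [Polynomial.coe_sub, coe_comp_eq_aeval]
    have := dvd_sub (dvd_add d4 d5) d2
    convert this using 1
    ring
  rw [Polynomial.X_pow_dvd_iff]
  rw [PowerSeries.X_pow_dvd_iff] at d3
  intro m hm
  have := d3 m hm
  rwa [Polynomial.coeff_coe] at this

end Formal

/-! ### From formal to analytic estimates: Taylor expansion in two variables -/

section Taylor

/-- Cauchy's estimates bound the coefficients by M / R^j, and for |y| ≤ R/2 the tail is dominated by
a geometric series of ratio 1/2. The constant is explicit so that the remainder can be made uniform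
in a parameter. -/
lemma norm_sub_taylor_le {h : ℂ → ℂ} {R M : ℝ} (hR : 0 < R)
    (hd : DifferentiableOn ℂ h (Metric.closedBall 0 R)) (hM : ∀ y ∈ Metric.closedBall 0 R, ‖h y‖ ≤ M)
    (n : ℕ) {y : ℂ} (hy : ‖y‖ ≤ R / 2) :
    ‖h y - ∑ j ∈ Finset.range n, iteratedDeriv j h 0 / j.factorial * y ^ j‖ ≤
      2 * M / R ^ n * ‖y‖ ^ n := by
  have hM0 : 0 ≤ M := (norm_nonneg _).trans (hM 0 (by simp [hR.le]))
  have hcoef : ∀ j : ℕ, ‖iteratedDeriv j h 0 / j.factorial‖ ≤ M / R ^ j := by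
    intro j
    have := Complex.norm_iteratedDeriv_le_of_forall_mem_sphere_norm_le (f := h) (c := 0) (C := M) j hR
      (hd.diffContOnCl_ball subset_rfl) (fun z hz => hM z (Metric.sphere_subset_closedBall hz))
    rw [norm_div, Complex.norm_natCast]
    have hf : (0 : ℝ) < j.factorial := by exact_mod_cast j.factorial_pos
    rw [div_le_iff₀ hf]
    calc _ ≤ _ := this
      _ = _ := by ring
  have hyR : y ∈ Metric.ball (0 : ℂ) R := by
    rw [mem_ball_zero_iff]; linarith
  have hs := Complex.hasSum_taylorSeries_on_ball (hd.mono Metric.ball_subset_closedBall) hyR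
  have hs' : HasSum (fun j : ℕ => iteratedDeriv j h 0 / j.factorial * y ^ j) (h y) := by
    have e : (fun j : ℕ => iteratedDeriv j h 0 / j.factorial * y ^ j) =
        fun j : ℕ => (j.factorial : ℂ)⁻¹ • (y - 0) ^ j • iteratedDeriv j h 0 := by
      funext j
      rw [sub_zero, smul_eq_mul, smul_eq_mul]
      ring
    rw [e]
    exact hs
  have hs2 := (hasSum_nat_add_iff (f := fun j : ℕ => iteratedDeriv j h 0 / j.factorial * y ^ j)
    (g := h y - ∑ j ∈ Finset.range n, iteratedDeriv j h 0 / j.factorial * y ^ j) n).2 (by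
      rw [sub_add_cancel]; exact hs')
  rw [← hs2.tsum_eq]
  have hq : ‖y‖ / R ≤ 1 / 2 := by
    rw [div_le_iff₀ hR]; linarith
  have hg := (hasSum_geometric_of_lt_one (r := (1 / 2 : ℝ)) (by norm_num) (by norm_num)).mul_left
    (M / R ^ n * ‖y‖ ^ n)
  have e : 2 * M / R ^ n * ‖y‖ ^ n = M / R ^ n * ‖y‖ ^ n * (1 - 1 / 2)⁻¹ := by ring
  rw [e]
  refine tsum_of_norm_bounded hg fun j => ?_
  rw [norm_mul, norm_pow]
  calc _ ≤ M / R ^ (j + n) * ‖y‖ ^ (j + n) := by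
        gcongr; exact hcoef _
    _ = M / R ^ n * ‖y‖ ^ n * (‖y‖ / R) ^ j := by
        rw [pow_add, pow_add, div_pow]
        field_simp
    _ ≤ M / R ^ n * ‖y‖ ^ n * (1 / 2) ^ j := by
        gcongr

/-- The partial derivative with respect to the second variable. -/
def partialSnd (f : ℂ × ℂ → ℂ) : ℂ × ℂ → ℂ := fun z => fderiv ℂ f z (0, 1)

lemma AnalyticOnNhd.partialSnd {f : ℂ × ℂ → ℂ} {S : Set (ℂ × ℂ)} (hf : AnalyticOnNhd ℂ f S) :
    AnalyticOnNhd ℂ (partialSnd f) S := fun z hz =>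
  ((ContinuousLinearMap.apply ℂ ℂ ((0, 1) : ℂ × ℂ)).analyticAt _).comp (hf.fderiv z hz)

lemma AnalyticOnNhd.partialSnd_iterate {f : ℂ × ℂ → ℂ} {S : Set (ℂ × ℂ)}
    (hf : AnalyticOnNhd ℂ f S) (j : ℕ) : AnalyticOnNhd ℂ (_root_.partialSnd^[j] f) S := by
  induction j generalizing f with
  | zero => exact hf
  | succ j ih => exact ih hf.partialSnd

lemma deriv_snd_eq_partialSnd {f : ℂ × ℂ → ℂ} {x y : ℂ} (hf : AnalyticAt ℂ f (x, y)) :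
    deriv (fun y => f (x, y)) y = partialSnd f (x, y) := by
  have h1 : HasFDerivAt f (fderiv ℂ f (x, y)) (x, y) := hf.differentiableAt.hasFDerivAt
  have h2 : HasDerivAt (fun y : ℂ => (x, y)) ((0 : ℂ), (1 : ℂ)) y :=
    (hasDerivAt_const y x).prodMk (hasDerivAt_id y)
  exact (h1.comp_hasDerivAt y h2).deriv

/-- Identifies the Taylor coefficients in y with iterated partial derivatives, which shows that they
are analytic in x. -/
lemma iteratedDeriv_snd_eq {f : ℂ × ℂ → ℂ} {S : Set (ℂ × ℂ)} (hS : IsOpen S)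
    (hf : AnalyticOnNhd ℂ f S) (j : ℕ) {x y : ℂ} (hxy : (x, y) ∈ S) :
    iteratedDeriv j (fun y => f (x, y)) y = (partialSnd^[j] f) (x, y) := by
  induction j generalizing f with
  | zero => simp
  | succ j ih =>
    rw [iteratedDeriv_succ', Function.iterate_succ_apply, ← ih hf.partialSnd]
    apply EventuallyEq.iteratedDeriv_eq
    have : ∀ᶠ y' in 𝓝 y, (x, y') ∈ S :=
      (Continuous.prodMk_right x).continuousAt.eventually_mem (hS.mem_nhds hxy)
    filter_upwards [this] with y' hy'
    exact deriv_snd_eq_partialSnd (hf _ hy')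

lemma AnalyticAt.sub_taylor_isBigO {g : ℂ → ℂ} (hg : AnalyticAt ℂ g 0) (n : ℕ) :
    (fun x => g x - ∑ i ∈ Finset.range n, iteratedDeriv i g 0 / i.factorial * x ^ i) =O[𝓝 0]
      fun x => ‖x‖ ^ n := by
  have := hg.hasFPowerSeriesAt.isBigO_sub_partialSum_pow n
  simpa [FormalMultilinearSeries.partialSum, FormalMultilinearSeries.ofScalars_apply_eq,
    mul_comm] using this

lemma coeffPair_taylorSeries (f : ℂ × ℂ → ℂ) (i j : ℕ) :
    coeffPair (taylorSeries f) i j =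
      iteratedDeriv i (fun x => iteratedDeriv j (fun y => f (x, y)) 0) 0 /
        (i.factorial * j.factorial) := by
  change taylorSeries f _ = _
  simp [taylorSeries]

/-- Taylor expansion of an analytic function of two variables. -/
lemma AnalyticAt.sub_taylorSeries_isBigO {f : ℂ × ℂ → ℂ} (hf : AnalyticAt ℂ f 0) (n : ℕ) :
    (fun z => f z - ∑ i ∈ Finset.range n, ∑ j ∈ Finset.range n,
      coeffPair (taylorSeries f) i j * (z.1 ^ i * z.2 ^ j)) =O[𝓝 0]
      fun z => ‖z.1‖ ^ n + ‖z.2‖ ^ n := by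
  obtain ⟨ρ, hρ, hball⟩ := Metric.eventually_nhds_iff_ball.1 hf.eventually_analyticAt
  have hfB : AnalyticOnNhd ℂ f (Metric.ball 0 ρ) := hball
  obtain ⟨σ, hσ, hbd⟩ := Metric.eventually_nhds_iff_ball.1
    (hf.continuousAt.norm.eventually (gt_mem_nhds (lt_add_one ‖f 0‖)))
  set R := min ρ σ / 2 with hRdef
  have hmin : 0 < min ρ σ := lt_min hρ hσ
  have hR : 0 < R := by positivity
  have hmem : ∀ x y : ℂ, ‖x‖ ≤ R → ‖y‖ ≤ R →
      (x, y) ∈ Metric.ball (0 : ℂ × ℂ) ρ ∧ (x, y) ∈ Metric.ball (0 : ℂ × ℂ) σ := by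
    intro x y hx hy
    have : ‖(x, y)‖ < min ρ σ := by
      rw [Prod.norm_mk]
      have := max_le hx hy
      linarith
    simp only [mem_ball_zero_iff]
    exact ⟨this.trans_le (min_le_left _ _), this.trans_le (min_le_right _ _)⟩
  -- The expansion is made in y first, uniformly in x, and then each coefficient `g j` is expanded
  -- in x; this is the order of differentiation in `taylorSeries`.
  set g : ℕ → ℂ → ℂ := fun j x => iteratedDeriv j (fun y => f (x, y)) 0 with hg
  have h0 : ((0 : ℂ), (0 : ℂ)) ∈ Metric.ball (0 : ℂ × ℂ) ρ := by simpa using hρ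
  have hgan : ∀ j, AnalyticAt ℂ (g j) 0 := by
    intro j
    have h1 : AnalyticAt ℂ (fun x : ℂ => (partialSnd^[j] f) (x, 0)) 0 :=
      AnalyticAt.comp₂ (f := fun x : ℂ => x) (g := fun _ : ℂ => (0 : ℂ))
        (hfB.partialSnd_iterate j _ h0) analyticAt_id analyticAt_const
    refine h1.congr ?_
    filter_upwards [Metric.closedBall_mem_nhds (0 : ℂ) hR] with x hx
    have hx : ‖x‖ ≤ R := by simpa using hx
    exact (iteratedDeriv_snd_eq Metric.isOpen_ball hfB j (hmem x 0 hx (by simpa using hR.le)).1).symm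
  have key1 : (fun z : ℂ × ℂ => f z - ∑ j ∈ Finset.range n, g j z.1 / j.factorial * z.2 ^ j) =O[𝓝 0]
      fun z => ‖z.1‖ ^ n + ‖z.2‖ ^ n := by
    refine Asymptotics.IsBigO.of_bound (2 * (‖f 0‖ + 1) / R ^ n) ?_
    filter_upwards [Metric.closedBall_mem_nhds (0 : ℂ × ℂ) (half_pos hR)] with z hz
    have hz : ‖z‖ ≤ R / 2 := by simpa using hz
    have hz1 : ‖z.1‖ ≤ R := (norm_fst_le z).trans (hz.trans (half_le_self hR.le))
    have hz2 : ‖z.2‖ ≤ R / 2 := (norm_snd_le z).trans hz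
    have := norm_sub_taylor_le (h := fun y => f (z.1, y)) (M := ‖f 0‖ + 1) hR ?_ ?_ n hz2
    · refine this.trans ?_
      rw [Real.norm_of_nonneg (by positivity)]
      gcongr
      exact le_add_of_nonneg_left (by positivity)
    · intro y hy
      have hy : ‖y‖ ≤ R := by simpa using hy
      exact ((hfB _ (hmem z.1 y hz1 hy).1).differentiableAt.comp y
        ((differentiableAt_const z.1).prodMk differentiableAt_id)).differentiableWithinAt
    · intro y hy
      have hy : ‖y‖ ≤ R := by simpa using hy
      exact (hbd _ (hmem z.1 y hz1 hy).2).le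
  have key2 : ∀ j, (fun z : ℂ × ℂ => (g j z.1 - ∑ i ∈ Finset.range n,
      iteratedDeriv i (g j) 0 / i.factorial * z.1 ^ i) / j.factorial * z.2 ^ j) =O[𝓝 0]
      fun z => ‖z.1‖ ^ n + ‖z.2‖ ^ n := by
    intro j
    have h1 := ((hgan j).sub_taylor_isBigO n).comp_tendsto
      (continuous_fst.tendsto' (0 : ℂ × ℂ) 0 rfl)
    have h2 : (fun z : ℂ × ℂ => z.2 ^ j / (j.factorial : ℂ)) =O[𝓝 0] fun _ => (1 : ℝ) := by
      refine Filter.Tendsto.isBigO_one ℝ (Continuous.tendsto ?_ _)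
      fun_prop
    have h3 := h1.mul h2
    refine (h3.congr_left ?_).trans ?_
    · intro z
      simp only [Function.comp]
      ring
    · refine Asymptotics.IsBigO.of_bound 1 (Eventually.of_forall fun z => ?_)
      simp only [Function.comp, mul_one, one_mul]
      rw [Real.norm_of_nonneg (by positivity), Real.norm_of_nonneg (by positivity)]
      exact le_add_of_nonneg_right (by positivity)
  have key3 := key1.add (Asymptotics.IsBigO.sum (s := Finset.range n) (l := 𝓝 (0 : ℂ × ℂ))
    fun j _ => key2 j)
  refine key3.congr_left fun z => ?_
  rw [Finset.sum_comm]
  have : ∀ a b c d : ℂ, b - c = d → a - b + d = a - c := by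
    intros a b c d h; rw [← h]; ring
  apply this
  rw [← Finset.sum_sub_distrib, Finset.sum_apply]
  refine Finset.sum_congr rfl fun j _ => ?_
  rw [sub_div, sub_mul]
  congr 1
  rw [Finset.sum_div, Finset.sum_mul]
  refine Finset.sum_congr rfl fun i _ => ?_
  rw [coeffPair_taylorSeries]
  simp only [hg]
  field_simp

lemma Polynomial.eval_isBigO_of_X_pow_dvd {P : Polynomial ℂ} {n : ℕ} (h : Polynomial.X ^ n ∣ P) :
    (fun x => P.eval x) =O[𝓝 0] fun x => ‖x‖ ^ n := by
  obtain ⟨Q, rfl⟩ := h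
  have h1 : (fun x : ℂ => x ^ n) =O[𝓝 0] fun x => ‖x‖ ^ n :=
    Asymptotics.IsBigO.of_bound 1 (Eventually.of_forall fun x => by simp)
  have h2 : (fun x : ℂ => Q.eval x) =O[𝓝 0] fun _ => (1 : ℝ) :=
    (Q.continuous.tendsto _).isBigO_one ℝ
  simpa using h1.mul h2

/-- Since J(0) = 0, J(x) = O(x), and the remainder |x|^n + |J(x)|^n is O(|x|^n). -/
lemma isBigO_along {f : ℂ × ℂ → ℂ} (hf : AnalyticAt ℂ f 0) (n : ℕ) {J : Polynomial ℂ}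
    (hJ : J.coeff 0 = 0) :
    (fun x => f (x, J.eval x) - (truncAlong (taylorSeries f) n J).eval x) =O[𝓝 0]
      fun x => ‖x‖ ^ n := by
  have hJ0 : J.eval 0 = 0 := by rw [← Polynomial.coeff_zero_eq_eval_zero, hJ]
  have ht : Tendsto (fun x : ℂ => (x, J.eval x)) (𝓝 0) (𝓝 0) := by
    have : Continuous fun x : ℂ => (x, J.eval x) := by
      have := J.continuous
      fun_prop
    exact this.tendsto' _ _ (by simp [hJ0])
  have h1 := (hf.sub_taylorSeries_isBigO n).comp_tendsto ht
  have hJX : (fun x => J.eval x) =O[𝓝 0] fun x => ‖x‖ ^ 1 :=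
    Polynomial.eval_isBigO_of_X_pow_dvd (by simpa [Polynomial.X_dvd_iff] using hJ)
  have h2 : (fun x : ℂ => ‖x‖ ^ n + ‖J.eval x‖ ^ n) =O[𝓝 0] fun x => ‖x‖ ^ n := by
    refine (Asymptotics.isBigO_refl _ _).add ?_
    simpa using (hJX.norm_left.pow n)
  refine (h1.trans h2).congr_left fun x => ?_
  simp [truncAlong, Polynomial.eval_finsetSum]

/-- The graph of the jet of `g` is invariant up to order `n`. -/
lemma FormalCurve.IsInvariant.isBigO {Γ : FormalCurve} {g : PowerSeries ℂ} {F : ℂ × ℂ → ℂ × ℂ}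
    (hΓ : Γ.IsInvariant F) (h : Γ.IsParametrization (PowerSeries.X, g)) (hF0 : F 0 = 0)
    (hF : AnalyticAt ℂ F 0) {n : ℕ} (hn : 1 ≤ n) :
    (fun x => (F (x, (PowerSeries.trunc n g).eval x)).2 -
      (PowerSeries.trunc n g).eval (F (x, (PowerSeries.trunc n g).eval x)).1) =O[𝓝 0]
      fun x => ‖x‖ ^ n := by
  set J := PowerSeries.trunc n g with hJdef
  have hJ : J.coeff 0 = 0 := h.coeff_trunc n
  have hJ0 : J.eval 0 = 0 := h.eval_trunc n
  have hF1 : AnalyticAt ℂ (fun z => (F z).1) 0 := analyticAt_fst.comp hF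
  have hF2 : AnalyticAt ℂ (fun z => (F z).2) 0 := analyticAt_snd.comp hF
  have c : ∀ f : ℂ × ℂ → ℂ, f 0 = 0 → MvPowerSeries.constantCoeff (taylorSeries f) = 0 := by
    intro f hf
    change taylorSeries f 0 = 0
    simpa [taylorSeries, Prod.mk_zero_zero] using hf
  have hdvd := hΓ.X_pow_dvd h (c _ (by simp [hF0])) (c _ (by simp [hF0])) n
  rw [← hJdef] at hdvd
  set Q1 := truncAlong (taylorSeries fun z => (F z).1) n J with hQ1
  set Q2 := truncAlong (taylorSeries fun z => (F z).2) n J with hQ2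
  have o1 := isBigO_along hF1 n hJ
  have o2 := isBigO_along hF2 n hJ
  have o3 := Polynomial.eval_isBigO_of_X_pow_dvd hdvd
  have ht : Tendsto (fun x : ℂ => (x, J.eval x)) (𝓝 0) (𝓝 0) := by
    have : Continuous fun x : ℂ => (x, J.eval x) := by
      have := J.continuous
      fun_prop
    exact this.tendsto' _ _ (by simp [hJ0])
  have t1 : Tendsto (fun x : ℂ => (F (x, J.eval x)).1) (𝓝 0) (𝓝 0) := by
    have := hF1.continuousAt.tendsto.comp ht
    simpa [hF0, Function.comp_def] using this
  have t2 : Tendsto (fun x : ℂ => Q1.eval x) (𝓝 0) (𝓝 0) := by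
    have hz : Tendsto (fun x : ℂ => ‖x‖ ^ n) (𝓝 0) (𝓝 0) := by
      have : Continuous fun x : ℂ => ‖x‖ ^ n := by fun_prop
      exact this.tendsto' _ _ (by simp; omega)
    have := t1.sub (o1.trans_tendsto hz)
    simpa using this
  have hJc : ContDiffAt ℂ 1 (fun x => J.eval x) 0 := J.differentiable.contDiff.contDiffAt
  obtain ⟨K, t, ht0, hK⟩ := hJc.exists_lipschitzOnWith
  have o4 : (fun x => J.eval (F (x, J.eval x)).1 - J.eval (Q1.eval x)) =O[𝓝 0]
      fun x => ‖x‖ ^ n := by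
    refine Asymptotics.IsBigO.trans (Asymptotics.IsBigO.of_bound K ?_) o1
    filter_upwards [t1.eventually_mem ht0, t2.eventually_mem ht0] with x h1 h2
    exact hK.norm_sub_le h1 h2
  refine ((o2.sub o4).add o3).congr_left fun x => ?_
  simp only [Polynomial.eval_sub, Polynomial.eval_comp]
  ring

end Taylor

/-! ### Transverse estimate and Fatou coordinate -/

section Estimates

lemma exists_bound_of_isBigO {E : Type*} [NormedAddCommGroup E] {f : E → ℂ} {g : E → ℝ}
    (h : f =O[𝓝 0] g) (hg : ∀ x, 0 ≤ g x) :
    ∃ C > 0, ∀ᶠ x in 𝓝 0, ‖f x‖ ≤ C * g x := by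
  obtain ⟨C, hC, h⟩ := h.exists_pos
  refine ⟨C, hC, ?_⟩
  filter_upwards [h.bound] with x hx
  rwa [Real.norm_of_nonneg (hg x)] at hx

lemma AnalyticAt.exists_norm_sub_le {f : ℂ × ℂ → ℂ} (hf : AnalyticAt ℂ f 0) :
    ∃ K : ℝ, 0 ≤ K ∧ ∃ t ∈ 𝓝 (0 : ℂ × ℂ), ∀ z ∈ t, ∀ w ∈ t, ‖f z - f w‖ ≤ K * ‖z - w‖ := by
  obtain ⟨K, t, ht, hK⟩ := (hf.contDiffAt (n := 1)).exists_lipschitzOnWith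
  exact ⟨K, K.2, t, ht, fun z hz w hw => hK.norm_sub_le hz hw⟩

lemma IsReducedForm.base_bound {F : ℂ × ℂ → ℂ × ℂ} {Γ : FormalCurve} {k p : ℕ} {μ : ℂ}
    {a : Polynomial ℂ} (hred : IsReducedForm F Γ k p μ a) :
    ∃ C > 0, ∀ᶠ z : ℂ × ℂ in 𝓝 0, ‖(F z).1 - z.1 + z.1 ^ (k + p + 1)‖ ≤
      C * (‖z.1‖ ^ (k + p + 1) * ‖z.2‖ + ‖z.1‖ ^ (2 * (k + p) + 1)) := by
  obtain ⟨A, B, hA, hB, h⟩ := hred.fst_eq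
  have bA := hA.continuousAt.norm.eventually (gt_mem_nhds (lt_add_one ‖A 0‖))
  have bB := hB.continuousAt.norm.eventually (gt_mem_nhds (lt_add_one ‖B 0‖))
  refine ⟨(‖A 0‖ + 1) + (‖B 0‖ + 1), by positivity, ?_⟩
  filter_upwards [h, bA, bB] with z hz h1 h2
  have e : (F z).1 - z.1 + z.1 ^ (k + p + 1) =
      z.1 ^ (k + p + 1) * z.2 * A z + z.1 ^ (2 * (k + p) + 1) * B z := by
    rw [hz]; ring
  rw [e]
  refine (norm_add_le _ _).trans ?_
  rw [norm_mul, norm_mul, norm_mul, norm_pow, norm_pow]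
  have hx : 0 ≤ ‖z.1‖ ^ (k + p + 1) * ‖z.2‖ := by positivity
  have hy : 0 ≤ ‖z.1‖ ^ (2 * (k + p) + 1) := by positivity
  have h1' : ‖A z‖ ≤ (‖A 0‖ + 1) + (‖B 0‖ + 1) := by linarith [norm_nonneg (B 0)]
  have h2' : ‖B z‖ ≤ (‖A 0‖ + 1) + (‖B 0‖ + 1) := by linarith [norm_nonneg (A 0)]
  exact (add_le_add (mul_le_mul_of_nonneg_left h1' hx)
    (mul_le_mul_of_nonneg_left h2' hy)).trans_eq (by ring)

/-- The height over the jet of the invariant curve is contracted by the factor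
`|μ (1 + x ^ k a(x))|`, up to terms of higher order. -/
lemma transverse_bound {F : ℂ × ℂ → ℂ × ℂ} {Γ : FormalCurve} {k p : ℕ} {μ : ℂ}
    {a : Polynomial ℂ} {g : PowerSeries ℂ} (hF0 : F 0 = 0) (hF : AnalyticAt ℂ F 0)
    (hΓ : Γ.IsInvariant F) (hred : IsReducedForm F Γ k p μ a)
    (h : Γ.IsParametrization (PowerSeries.X, g)) {n : ℕ} (hn : 1 ≤ n) :
    ∃ C > 0, ∀ᶠ z : ℂ × ℂ in 𝓝 0,
      ‖(F z).2 - (PowerSeries.trunc n g).eval (F z).1‖ ≤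
        ‖z.2 - (PowerSeries.trunc n g).eval z.1‖ *
          (‖μ * (1 + z.1 ^ k * a.eval z.1)‖ + C * ‖z.1‖ ^ (k + p + 1)) + C * ‖z.1‖ ^ n := by
  obtain ⟨C₀, hC₀, hinv⟩ := exists_bound_of_isBigO (hΓ.isBigO h hF0 hF hn) (fun x => by positivity)
  set J := PowerSeries.trunc n g with hJdef
  have hJ0 : J.eval 0 = 0 := h.eval_trunc n
  obtain ⟨A, B, hA, hB, h1⟩ := hred.fst_eq
  obtain ⟨D, b, hD, hb, h2⟩ := hred.snd_eq
  obtain ⟨K₁, hK₁, t₁, ht₁, l₁⟩ := (analyticAt_snd.mul hA : AnalyticAt ℂ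
    (fun z : ℂ × ℂ => z.2 * A z) 0).exists_norm_sub_le
  obtain ⟨K₂, hK₂, t₂, ht₂, l₂⟩ := hB.exists_norm_sub_le
  obtain ⟨K₃, hK₃, t₃, ht₃, l₃⟩ := (analyticAt_snd.mul hD : AnalyticAt ℂ
    (fun z : ℂ × ℂ => z.2 * D z) 0).exists_norm_sub_le
  have hJc : ContDiffAt ℂ 1 (fun x => J.eval x) 0 := J.differentiable.contDiff.contDiffAt
  obtain ⟨K₄, t₄, ht₄, l₄⟩ := hJc.exists_lipschitzOnWith
  have hπ : Tendsto (fun z : ℂ × ℂ => (z.1, J.eval z.1)) (𝓝 0) (𝓝 0) := by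
    have : Continuous fun z : ℂ × ℂ => (z.1, J.eval z.1) := by
      have := J.continuous
      fun_prop
    exact this.tendsto' _ _ (by simp [hJ0])
  have hF1 : Tendsto (fun z => (F z).1) (𝓝 0) (𝓝 0) := by
    have : AnalyticAt ℂ (fun z => (F z).1) 0 := analyticAt_fst.comp hF
    simpa [hF0] using this.continuousAt.tendsto
  have hx : Tendsto (fun z : ℂ × ℂ => z.1) (𝓝 0) (𝓝 0) := continuous_fst.tendsto' _ _ rfl
  have hx1 : ∀ᶠ z : ℂ × ℂ in 𝓝 0, ‖z.1‖ < 1 :=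
    hx.norm.eventually (gt_mem_nhds (by simp))
  refine ⟨‖μ‖ * K₃ + K₄ * (K₁ + K₂) + C₀, by positivity, ?_⟩
  filter_upwards [hx.eventually hinv, h1, h2, hπ.eventually h1, hπ.eventually h2, ht₁, ht₂, ht₃,
    hπ.eventually_mem ht₁, hπ.eventually_mem ht₂, hπ.eventually_mem ht₃,
    hF1.eventually_mem ht₄, (hF1.comp hπ).eventually_mem ht₄, hx1] with
    z i e1 e2 e1' e2' m1 m2 m3 m1' m2' m3' m4 m4' hz1
  -- `z` is compared with the point of the jet's graph over the same x. The term b(x) cancels, the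
  -- other differences are Lipschitz in the height `v`, and what is left is the invariance defect of
  -- the graph, of size |x|^n.
  set z' : ℂ × ℂ := (z.1, J.eval z.1) with hz'
  set v := z.2 - J.eval z.1 with hv
  have hzz' : ‖z - z'‖ = ‖v‖ := by
    have : z - z' = (0, v) := by
      ext <;> simp [hz', hv]
    rw [this, Prod.norm_mk, norm_zero, max_eq_right (norm_nonneg _)]
  have b1 := l₁ z m1 z' m1'
  have b2 := l₂ z m2 z' m2'
  have b3 := l₃ z m3 z' m3'
  rw [hzz'] at b1 b2 b3
  replace b1 : ‖z.2 * A z - z'.2 * A z'‖ ≤ K₁ * ‖v‖ := b1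
  replace b3 : ‖z.2 * D z - z'.2 * D z'‖ ≤ K₃ * ‖v‖ := b3
  have b4 : ‖J.eval (F z).1 - J.eval (F z').1‖ ≤ K₄ * ‖(F z).1 - (F z').1‖ :=
    l₄.norm_sub_le m4 m4'
  have q1 : ‖(F z).1 - (F z').1‖ ≤ (K₁ + K₂) * ‖z.1‖ ^ (k + p + 1) * ‖v‖ := by
    have e : (F z).1 - (F z').1 = z.1 ^ (k + p + 1) * (z.2 * A z - z'.2 * A z') +
        z.1 ^ (2 * k + 2 * p + 1) * (B z - B z') := by
      rw [e1, e1']; ring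
    rw [e]
    refine (norm_add_le _ _).trans ?_
    rw [norm_mul, norm_mul, norm_pow, norm_pow]
    have hp : ‖z.1‖ ^ (2 * k + 2 * p + 1) ≤ ‖z.1‖ ^ (k + p + 1) :=
      pow_le_pow_of_le_one (norm_nonneg _) hz1.le (by omega)
    calc _ ≤ ‖z.1‖ ^ (k + p + 1) * (K₁ * ‖v‖) + ‖z.1‖ ^ (k + p + 1) * (K₂ * ‖v‖) := by gcongr
      _ = _ := by ring
  have q2 : (F z).2 - J.eval (F z).1 = μ * (1 + z.1 ^ k * a.eval z.1) * v +
      μ * z.1 ^ (k + p + 1) * (z.2 * D z - z'.2 * D z') - (J.eval (F z).1 - J.eval (F z').1) +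
      ((F z').2 - J.eval (F z').1) := by
    rw [e2, e2']
    simp only [hz', hv]
    ring
  rw [q2]
  have hC : 0 ≤ K₄ * (K₁ + K₂) := by positivity
  have i' : ‖(F z').2 - J.eval (F z').1‖ ≤ C₀ * ‖z.1‖ ^ n := i
  have n1 : ‖μ * z.1 ^ (k + p + 1) * (z.2 * D z - z'.2 * D z')‖ ≤
      ‖μ‖ * K₃ * (‖z.1‖ ^ (k + p + 1) * ‖v‖) := by
    rw [norm_mul, norm_mul, norm_pow]
    calc _ ≤ ‖μ‖ * ‖z.1‖ ^ (k + p + 1) * (K₃ * ‖v‖) := by gcongr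
      _ = _ := by ring
  have n2 : ‖J.eval (F z).1 - J.eval (F z').1‖ ≤
      K₄ * (K₁ + K₂) * (‖z.1‖ ^ (k + p + 1) * ‖v‖) := by
    calc _ ≤ _ := b4
      _ ≤ K₄ * ((K₁ + K₂) * ‖z.1‖ ^ (k + p + 1) * ‖v‖) := by gcongr
      _ = _ := by ring
  have n3 := norm_add_le (μ * (1 + z.1 ^ k * a.eval z.1) * v +
      μ * z.1 ^ (k + p + 1) * (z.2 * D z - z'.2 * D z') - (J.eval (F z).1 - J.eval (F z').1))
      ((F z').2 - J.eval (F z').1)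
  have n4 := norm_sub_le (μ * (1 + z.1 ^ k * a.eval z.1) * v +
      μ * z.1 ^ (k + p + 1) * (z.2 * D z - z'.2 * D z')) (J.eval (F z).1 - J.eval (F z').1)
  have n5 := norm_add_le (μ * (1 + z.1 ^ k * a.eval z.1) * v)
      (μ * z.1 ^ (k + p + 1) * (z.2 * D z - z'.2 * D z'))
  have n6 := norm_mul (μ * (1 + z.1 ^ k * a.eval z.1)) v
  have hP : 0 ≤ ‖z.1‖ ^ (k + p + 1) * ‖v‖ := by positivity
  have hQ : 0 ≤ ‖z.1‖ ^ n := by positivity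
  have hCP := mul_nonneg hC₀.le hP
  have hCQ : 0 ≤ (‖μ‖ * K₃ + K₄ * (K₁ + K₂)) * ‖z.1‖ ^ n := by positivity
  rw [n6] at n5
  nlinarith

/-- The coordinate `1 / (r x ^ r)`. -/
def fatou (r : ℕ) (x : ℂ) : ℂ := 1 / (r * x ^ r)

lemma norm_fatou (r : ℕ) (x : ℂ) : ‖fatou r x‖ = 1 / (r * ‖x‖ ^ r) := by
  simp [fatou]

lemma exists_inv_pow_bound (r : ℕ) :
    ∃ C > 0, ∀ᶠ e : ℂ in 𝓝 0, ‖((1 + e) ^ r)⁻¹ - 1 + r * e‖ ≤ C * ‖e‖ ^ 2 := by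
  have han : AnalyticAt ℂ (fun e : ℂ => ((1 + e) ^ r)⁻¹) 0 := by
    apply AnalyticAt.inv
    · fun_prop
    · simp
  have h := han.sub_taylor_isBigO 2
  obtain ⟨C, hC, h⟩ := exists_bound_of_isBigO h (fun x => by positivity)
  refine ⟨C, hC, ?_⟩
  filter_upwards [h] with e he
  have hd : deriv (fun e : ℂ => ((1 + e) ^ r)⁻¹) 0 = -r := by
    have h1 : HasDerivAt (fun e : ℂ => 1 + e) 1 0 := (hasDerivAt_id _).const_add 1
    have := ((h1.fun_pow r).fun_inv (by simp)).deriv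
    simpa using this
  simp only [Finset.sum_range_succ, Finset.sum_range_zero, iteratedDeriv_zero, iteratedDeriv_one,
    hd] at he
  convert he using 2
  simp
  ring

/-- In the coordinate `1 / (r x ^ r)`, the map is `z ↦ z + 1 + O(x ^ r)`. -/
lemma fatou_step (r : ℕ) (hr : 1 ≤ r) {C₁ : ℝ} (hC₁ : 0 < C₁) :
    ∃ C > 0, ∃ δ > 0, ∀ x x₁ : ℂ, x ≠ 0 → ‖x‖ < δ →
      ‖x₁ - x + x ^ (r + 1)‖ ≤ C₁ * ‖x‖ ^ (2 * r + 1) →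
      ‖fatou r x₁ - fatou r x - 1‖ ≤ C * ‖x‖ ^ r ∧ ‖x₁ - x‖ ≤ C * ‖x‖ ^ (r + 1) := by
  obtain ⟨C₂, hC₂, h⟩ := exists_inv_pow_bound r
  obtain ⟨η, hη, h⟩ := Metric.eventually_nhds_iff_ball.1 h
  refine ⟨C₁ + C₂ * (1 + C₁) ^ 2 + (1 + C₁), by positivity, min 1 (η / (1 + C₁)), by positivity, ?_⟩
  intro x x₁ hx hδ hb
  have hx1 : ‖x‖ < 1 := hδ.trans_le (min_le_left _ _)
  have hx2 : ‖x‖ * (1 + C₁) < η := by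
    have := hδ.trans_le (min_le_right _ _)
    rwa [lt_div_iff₀ (by positivity)] at this
  have hx0 : 0 < ‖x‖ := norm_pos_iff.2 hx
  -- The relative displacement is e = -x^r + O(x^(2r)). The Fatou coordinate is multiplied by (1 +
  -- e)^(-r) = 1 - re + O(e²), which adds 1 up to O(x^r).
  set e := (x₁ - x) / x with he
  have hxe : x₁ = x * (1 + e) := by rw [he]; field_simp; ring
  have hb' : ‖e + x ^ r‖ ≤ C₁ * ‖x‖ ^ (2 * r) := by
    have e1 : x₁ - x + x ^ (r + 1) = x * (e + x ^ r) := by rw [hxe]; ring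
    rw [e1, norm_mul] at hb
    have : ‖x‖ * ‖e + x ^ r‖ ≤ ‖x‖ * (C₁ * ‖x‖ ^ (2 * r)) := by
      calc _ ≤ _ := hb
        _ = _ := by ring
    exact le_of_mul_le_mul_left this hx0
  have hp : ‖x‖ ^ (2 * r) ≤ ‖x‖ ^ r := pow_le_pow_of_le_one hx0.le hx1.le (by omega)
  have hen : ‖e‖ ≤ (1 + C₁) * ‖x‖ ^ r := by
    have : e = (e + x ^ r) - x ^ r := by ring
    rw [this]
    refine (norm_sub_le _ _).trans ?_
    rw [norm_pow]
    have := mul_le_mul_of_nonneg_left hp hC₁.le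
    linarith
  have hpr : ‖x‖ ^ r ≤ ‖x‖ := by
    calc _ ≤ ‖x‖ ^ 1 := pow_le_pow_of_le_one hx0.le hx1.le hr
      _ = _ := pow_one _
  have heη : ‖e‖ < η := by
    calc _ ≤ _ := hen
      _ ≤ (1 + C₁) * ‖x‖ := by gcongr
      _ < η := by linarith
  have hh := h e (by simpa using heη)
  have hr0 : (r : ℂ) ≠ 0 := by exact_mod_cast (by omega : r ≠ 0)
  have hr1 : (1 : ℝ) ≤ r := by exact_mod_cast hr
  have hxr : x ^ r ≠ 0 := pow_ne_zero _ hx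
  constructor
  · have e2 : fatou r x₁ - fatou r x - 1 =
        1 / (r * x ^ r) * (((1 + e) ^ r)⁻¹ - 1 + r * e) - (e + x ^ r) / x ^ r := by
      rw [fatou, fatou, hxe, mul_pow]
      generalize hE : (1 + e) ^ r = E
      -- E = 0 means x₁ = 0, which is not excluded here; the identity survives because both inverses
      -- then take the default value 0.
      by_cases hE0 : E = 0
      · rw [hE0]; simp; field_simp; ring
      · field_simp; ring
    rw [e2]
    refine (norm_sub_le _ _).trans ?_
    rw [norm_mul, norm_div, norm_div, norm_mul, norm_pow, norm_one, Complex.norm_natCast]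
    have k1 : ‖e‖ ^ 2 ≤ ((1 + C₁) * ‖x‖ ^ r) ^ 2 := by gcongr
    have k2 : 1 / (r * ‖x‖ ^ r) * ‖((1 + e) ^ r)⁻¹ - 1 + r * e‖ ≤
        C₂ * (1 + C₁) ^ 2 * ‖x‖ ^ r := by
      rw [one_div, inv_mul_le_iff₀ (by positivity)]
      have : C₂ * ‖e‖ ^ 2 ≤ C₂ * ((1 + C₁) * ‖x‖ ^ r) ^ 2 := by gcongr
      have h3 : C₂ * ((1 + C₁) * ‖x‖ ^ r) ^ 2 ≤ r * (C₂ * ((1 + C₁) * ‖x‖ ^ r) ^ 2) :=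
        le_mul_of_one_le_left (by positivity) hr1
      calc _ ≤ _ := hh
        _ ≤ _ := this
        _ ≤ _ := h3
        _ = _ := by ring
    have k3 : ‖e + x ^ r‖ / ‖x‖ ^ r ≤ C₁ * ‖x‖ ^ r := by
      rw [div_le_iff₀ (by positivity)]
      calc _ ≤ _ := hb'
        _ = _ := by ring
    have : 0 ≤ (1 + C₁) * ‖x‖ ^ r := by positivity
    linarith
  · have : x₁ - x = x * e := by rw [hxe]; ring
    rw [this, norm_mul]
    calc _ ≤ ‖x‖ * ((1 + C₁) * ‖x‖ ^ r) := by gcongr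
      _ = (1 + C₁) * ‖x‖ ^ (r + 1) := by ring
      _ ≤ _ := by
        have : 0 ≤ C₁ + C₂ * (1 + C₁) ^ 2 := by positivity
        exact mul_le_mul_of_nonneg_right (by linarith) (by positivity)

end Estimates

/-! ### The transverse multiplier along a node direction -/

section Node

/-- Replacing one factor w by |w| costs |w|^(p+1), so each replacement gains a relative factor
|w|^p. For i ≥ k the error has order at least k + p, beyond every coefficient tested by the node
condition. -/
lemma norm_pow_sub_norm_pow_le {w : ℂ} {p : ℕ} (h : ‖w - ‖w‖‖ ≤ ‖w‖ ^ (p + 1)) (i : ℕ) :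
    ‖w ^ i - (‖w‖ : ℂ) ^ i‖ ≤ i * ‖w‖ ^ (i + p) := by
  induction i with
  | zero => simp
  | succ i ih =>
    have e : w ^ (i + 1) - (‖w‖ : ℂ) ^ (i + 1) =
        w * (w ^ i - (‖w‖ : ℂ) ^ i) + (‖w‖ : ℂ) ^ i * (w - ‖w‖) := by ring
    rw [e]
    refine (norm_add_le _ _).trans ?_
    rw [norm_mul, norm_mul, norm_pow, Complex.norm_real, norm_norm]
    calc _ ≤ ‖w‖ * (i * ‖w‖ ^ (i + p)) + ‖w‖ ^ i * ‖w‖ ^ (p + 1) := by gcongr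
      _ = _ := by push_cast; ring

lemma analyticAt_log_one_add_pow {k : ℕ} (hk : 1 ≤ k) (a : Polynomial ℂ) :
    AnalyticAt ℂ (fun x : ℂ => Complex.log (1 + x ^ k * a.eval x)) 0 := by
  have ha : AnalyticAt ℂ (fun x : ℂ => a.eval x) 0 := a.differentiable.analyticAt 0
  refine AnalyticAt.clog (by fun_prop) ?_
  simp [show k ≠ 0 by omega, Complex.slitPlane]

/-- log(1 + u) is u times an analytic function, so the composition with u = x^k a(x) is divisible by
x^k. -/
lemma iteratedDeriv_log_one_add_pow {k : ℕ} (hk : 1 ≤ k) (a : Polynomial ℂ) {i : ℕ} (hi : i < k) :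
    iteratedDeriv i (fun x : ℂ => Complex.log (1 + x ^ k * a.eval x)) 0 = 0 := by
  have ha : AnalyticAt ℂ (fun x : ℂ => a.eval x) 0 := a.differentiable.analyticAt 0
  have hl : AnalyticAt ℂ (fun u : ℂ => Complex.log (1 + u)) 0 :=
    AnalyticAt.clog (by fun_prop) (by simp [Complex.slitPlane])
  obtain ⟨m, hm, hlm⟩ := (natCast_le_analyticOrderAt hl (n := 1)).1 (by
    rw [natCast_le_analyticOrderAt_iff_iteratedDeriv_eq_zero hl]
    intro i hi
    obtain rfl : i = 0 := by omega
    simp)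
  have hu : AnalyticAt ℂ (fun x : ℂ => x ^ k * a.eval x) 0 := by fun_prop
  have ht : Tendsto (fun x : ℂ => x ^ k * a.eval x) (𝓝 0) (𝓝 0) := by
    simpa [show k ≠ 0 by omega] using hu.continuousAt.tendsto
  refine (natCast_le_analyticOrderAt_iff_iteratedDeriv_eq_zero
    (analyticAt_log_one_add_pow hk a) (n := k)).1 ?_ i hi
  rw [natCast_le_analyticOrderAt (analyticAt_log_one_add_pow hk a)]
  refine ⟨fun x => a.eval x * m (x ^ k * a.eval x),
    ha.mul (AnalyticAt.comp (g := m) (by simpa [show k ≠ 0 by omega] using hm) hu), ?_⟩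
  filter_upwards [ht.eventually hlm] with x hx
  rw [hx]
  simp only [sub_zero, smul_eq_mul]
  ring

/-- Along a node direction the transverse multiplier is at most `1 - c |x| ^ (k + p - 1)`. -/
lemma node_bound {k p : ℕ} {μ : ℂ} {a : Polynomial ℂ} {ξ : ℂ} (hk : 1 ≤ k) (hξ : ‖ξ‖ = 1)
    (hnode : IsNodeDirection k p μ a ξ) :
    ∃ c > 0, ∀ᶠ w : ℂ in 𝓝 0, w ≠ 0 → ‖w - ‖w‖‖ ≤ ‖w‖ ^ (p + 1) →
      ‖μ * (1 + (ξ * w) ^ k * a.eval (ξ * w))‖ ≤ 1 - c * ‖w‖ ^ (k + p - 1) := by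
  have ha : Continuous fun x : ℂ => a.eval x := a.continuous
  have hsmall : ∀ ε > (0 : ℝ), ∀ᶠ w : ℂ in 𝓝 0, ‖w‖ < ε := fun ε hε => by
    filter_upwards [Metric.ball_mem_nhds (0 : ℂ) hε] with w hw
    simpa using hw
  by_cases hμ : ‖μ‖ < 1
  · refine ⟨(1 - ‖μ‖) / 2, by linarith, ?_⟩
    have ht : Tendsto (fun w : ℂ => ‖μ * (1 + (ξ * w) ^ k * a.eval (ξ * w))‖) (𝓝 0) (𝓝 ‖μ‖) := by
      have : Continuous fun w : ℂ => ‖μ * (1 + (ξ * w) ^ k * a.eval (ξ * w))‖ := by fun_prop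
      exact this.tendsto' _ _ (by simp [show k ≠ 0 by omega])
    filter_upwards [ht.eventually (gt_mem_nhds (show ‖μ‖ < (1 + ‖μ‖) / 2 by linarith)),
      hsmall 1 one_pos] with w h1 h2 _ _
    have h3 : ‖w‖ ^ (k + p - 1) ≤ 1 := pow_le_one₀ (norm_nonneg _) h2.le
    have : (1 - ‖μ‖) / 2 * ‖w‖ ^ (k + p - 1) ≤ (1 - ‖μ‖) / 2 * 1 := by
      apply mul_le_mul_of_nonneg_left h3; linarith
    linarith
  -- `i` is the first non-zero entry of the lexicographic comparison. It is not the entry ln |μ|,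
  -- since |μ| ≥ 1 here; hence |μ| = 1 and only the logarithm of 1 + x^k a(x) matters.
  · obtain ⟨i, heq, hlt⟩ := hnode
    have heq' : ∀ j < i, (Fin.cons (Real.log ‖μ‖) (fun j : Fin p =>
        (ξ ^ (k + (j : ℕ)) * infinitesimalCoeff k a j).re) : Fin (p + 1) → ℝ) j = 0 := heq
    have hlt' : (Fin.cons (Real.log ‖μ‖) (fun j : Fin p =>
        (ξ ^ (k + (j : ℕ)) * infinitesimalCoeff k a j).re) : Fin (p + 1) → ℝ) i < 0 := hlt
    clear heq hlt
    rcases Fin.eq_zero_or_eq_succ i with rfl | ⟨j, rfl⟩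
    · rw [Fin.cons_zero] at hlt'
      exact absurd (Real.log_nonneg (not_lt.1 hμ)) (not_le.2 hlt')
    have hμ1 : ‖μ‖ = 1 := by
      have h0 := heq' 0 (Fin.succ_pos j)
      rw [Fin.cons_zero] at h0
      rcases Real.log_eq_zero.1 h0 with h | h | h
      · rw [h] at hμ; norm_num at hμ
      · exact h
      · linarith [norm_nonneg μ]
    rw [Fin.cons_succ] at hlt'
    set g : ℂ → ℂ := fun x => Complex.log (1 + x ^ k * a.eval x) with hg
    set t : ℕ → ℂ := fun i => iteratedDeriv i g 0 / i.factorial with ht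
    have htk : ∀ i < k, t i = 0 := fun i hi => by
      simp only [ht, hg, iteratedDeriv_log_one_add_pow hk a hi, zero_div]
    have hα : ∀ i < k + j, (t i * ξ ^ i).re = 0 := by
      intro i hi
      by_cases hik : i < k
      · rw [htk i hik]; simp
      · obtain ⟨m, rfl⟩ := Nat.exists_eq_add_of_le (not_lt.1 hik)
        have hm : m < j := by omega
        have := heq' (Fin.succ ⟨m, hm.trans j.2⟩) (Fin.succ_lt_succ_iff.2 hm)
        rw [Fin.cons_succ] at this
        rw [mul_comm]
        exact this
    set β := -(t (k + j) * ξ ^ (k + (j : ℕ))).re with hβ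
    have hβ0 : 0 < β := by
      rw [hβ, mul_comm, neg_pos]
      exact hlt'
    set n := k + (j : ℕ) + 1 with hn
    obtain ⟨C, hC, hT⟩ := exists_bound_of_isBigO
      ((analyticAt_log_one_add_pow hk a).sub_taylor_isBigO n) (fun x => by positivity)
    set D := ∑ i ∈ Finset.range n, ‖t i‖ * i with hD
    have hD0 : 0 ≤ D := Finset.sum_nonneg fun i _ => by positivity
    have hξt : Tendsto (fun w : ℂ => ξ * w) (𝓝 0) (𝓝 0) :=
      (continuous_const_mul ξ).tendsto' _ _ (mul_zero _)
    have hne : ∀ᶠ x : ℂ in 𝓝 0, 1 + x ^ k * a.eval x ≠ 0 := by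
      have : Continuous fun x : ℂ => 1 + x ^ k * a.eval x := by fun_prop
      refine this.continuousAt.eventually_ne ?_
      simp [show k ≠ 0 by omega]
    refine ⟨β / 4, by positivity, ?_⟩
    filter_upwards [hξt.eventually hT, hξt.eventually hne, hsmall 1 one_pos,
      hsmall (β / (2 * (C + D))) (by positivity), hsmall (1 / β) (by positivity)] with
      w hw hw0 h1 h2 h4 hwne h3
    set s := ‖w‖ with hs
    have hs0 : 0 < s := norm_pos_iff.2 hwne
    have hξw : ‖ξ * w‖ = s := by rw [norm_mul, hξ, one_mul]
    rw [hξw] at hw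
    have hterm : ∀ i ∈ Finset.range n, (t i * (ξ * w) ^ i).re ≤
        (t i * ξ ^ i).re * s ^ i + ‖t i‖ * i * s ^ n := by
      intro i _
      by_cases hik : i < k
      · rw [htk i hik]; simp
      · have e : t i * (ξ * w) ^ i = t i * ξ ^ i * ((s ^ i : ℝ) : ℂ) +
            t i * ξ ^ i * (w ^ i - (s : ℂ) ^ i) := by push_cast; ring
        rw [e, Complex.add_re, Complex.re_mul_ofReal]
        gcongr
        refine (Complex.re_le_norm _).trans ?_
        rw [norm_mul, norm_mul, norm_pow, hξ, one_pow, mul_one, mul_assoc]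
        refine mul_le_mul_of_nonneg_left ((norm_pow_sub_norm_pow_le h3 i).trans ?_) (norm_nonneg _)
        refine mul_le_mul_of_nonneg_left ?_ (Nat.cast_nonneg _)
        -- i ≥ k and j < p give i + p ≥ k + j + 1 = n.
        exact pow_le_pow_of_le_one hs0.le h1.le (by have := j.2; omega)
    have hsum : (∑ i ∈ Finset.range n, t i * (ξ * w) ^ i).re ≤ -β * s ^ (k + (j : ℕ)) + D * s ^ n := by
      rw [Complex.re_sum]
      refine (Finset.sum_le_sum hterm).trans ?_
      rw [Finset.sum_add_distrib, ← Finset.sum_mul]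
      refine add_le_add (le_of_eq ?_) le_rfl
      rw [hn, Finset.sum_range_succ, Finset.sum_eq_zero, zero_add, hβ, neg_neg]
      intro i hi
      rw [hα i (Finset.mem_range.1 hi), zero_mul]
    have hre : (g (ξ * w)).re ≤ -(β / 2) * s ^ (k + (j : ℕ)) := by
      have e : g (ξ * w) = (g (ξ * w) - ∑ i ∈ Finset.range n, t i * (ξ * w) ^ i) +
        ∑ i ∈ Finset.range n, t i * (ξ * w) ^ i := by ring
      have h5 := (Complex.re_le_norm (g (ξ * w) - ∑ i ∈ Finset.range n, t i * (ξ * w) ^ i)).trans hw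
      have h6 : (g (ξ * w)).re = (g (ξ * w) - ∑ i ∈ Finset.range n, t i * (ξ * w) ^ i).re +
        (∑ i ∈ Finset.range n, t i * (ξ * w) ^ i).re := by rw [← Complex.add_re, ← e]
      have h7 : (C + D) * s ≤ β / 2 := by
        have := (lt_div_iff₀ (by positivity)).1 h2
        linarith
      have h8 := mul_le_mul_of_nonneg_right h7 (pow_nonneg hs0.le (k + (j : ℕ)))
      have h9 : s ^ n = s * s ^ (k + (j : ℕ)) := by rw [hn, pow_succ']
      rw [h9] at h5 hsum
      rw [h6]
      linarith
    have hexp : ‖1 + (ξ * w) ^ k * a.eval (ξ * w)‖ = Real.exp (g (ξ * w)).re := by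
      rw [← Complex.norm_exp, hg, Complex.exp_log hw0]
    rw [norm_mul, hμ1, one_mul, hexp]
    set σ := β / 2 * s ^ (k + (j : ℕ)) with hσ
    have hσ0 : 0 ≤ σ := by positivity
    have hσ1 : σ ≤ 1 := by
      have h5 : s ^ (k + (j : ℕ)) ≤ s := by
        calc _ ≤ s ^ 1 := pow_le_pow_of_le_one hs0.le h1.le (by omega)
          _ = s := pow_one s
      have h6 := (lt_div_iff₀ hβ0).1 h4
      nlinarith
    -- exp(-σ) ≤ 1/(1 + σ) ≤ 1 - σ/2 for 0 ≤ σ ≤ 1.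
    have hE : Real.exp (g (ξ * w)).re ≤ 1 - σ / 2 := by
      have h5 : Real.exp (g (ξ * w)).re ≤ Real.exp (-σ) := Real.exp_le_exp.2 (by linarith)
      refine h5.trans ?_
      rw [Real.exp_neg]
      have h6 := Real.add_one_le_exp σ
      rw [inv_le_iff_one_le_mul₀ (Real.exp_pos _)]
      nlinarith
    refine hE.trans ?_
    have h5 : s ^ (k + p - 1) ≤ s ^ (k + (j : ℕ)) :=
      pow_le_pow_of_le_one hs0.le h1.le (by have := j.2; omega)
    have := mul_le_mul_of_nonneg_left h5 (show 0 ≤ β / 4 by positivity)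
    rw [hσ]
    linarith

end Node

/-! ### Geometry of the petals -/

section Petal

/-- The region `Re z > K`, `|Im z| < B log (Re z)`. -/
def logRegion (K B : ℝ) : Set ℂ := {z | K < z.re ∧ |z.im| < B * Real.log z.re}

/-- The connected domain around the direction `ξ` which is mapped onto `logRegion K B` by
`x ↦ 1 / (r x ^ r)`. -/
def petal (r : ℕ) (ξ : ℂ) (K B : ℝ) : Set ℂ :=
  {x | x ≠ 0 ∧ |(ξ⁻¹ * x).arg| < Real.pi / (2 * r) ∧ fatou r x ∈ logRegion K B}

/-- The inverse of `x ↦ 1 / (r x ^ r)` on the petals around `ξ`. -/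
def fatouInv (r : ℕ) (ξ z : ℂ) : ℂ := ξ * Complex.exp (-(Complex.log (r * z) / r))

/-- |Im z| is convex and log is concave. Convexity is what makes the petals simply connected. -/
lemma logRegion_convex {K B : ℝ} (hK : 1 ≤ K) (hB : 0 < B) : Convex ℝ (logRegion K B) := by
  intro z hz w hw s t hs ht hst
  have hlog := strictConcaveOn_log_Ioi.concaveOn.2 (x := z.re) (y := w.re)
    (Set.mem_Ioi.2 (by linarith [hz.1])) (Set.mem_Ioi.2 (by linarith [hw.1])) hs ht hst
  obtain ⟨hz1, hz2⟩ := hz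
  obtain ⟨hw1, hw2⟩ := hw
  simp only [smul_eq_mul] at hlog
  have hre : (s • z + t • w).re = s * z.re + t * w.re := by simp
  have him : (s • z + t • w).im = s * z.im + t * w.im := by simp
  -- The strict inequality is carried by the summand with coefficient s, so s = 0 is treated apart.
  rcases hs.eq_or_lt with rfl | hs'
  · have : t = 1 := by linarith
    subst this
    have hw : w ∈ logRegion K B := ⟨hw1, hw2⟩
    simpa using hw
  refine ⟨?_, ?_⟩
  · rw [hre]
    nlinarith
  · rw [hre, him]
    have h1 : |s * z.im + t * w.im| ≤ s * |z.im| + t * |w.im| := by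
      refine (abs_add_le _ _).trans ?_
      rw [abs_mul, abs_mul, abs_of_nonneg hs, abs_of_nonneg ht]
    have h2 : s * |z.im| < s * (B * Real.log z.re) := mul_lt_mul_of_pos_left hz2 hs'
    have h3 : t * |w.im| ≤ t * (B * Real.log w.re) := mul_le_mul_of_nonneg_left hw2.le ht
    have h4 := mul_le_mul_of_nonneg_left hlog hB.le
    nlinarith

lemma logRegion_isOpen {K B : ℝ} (hK : 1 ≤ K) : IsOpen (logRegion K B) := by
  have h1 : IsOpen {z : ℂ | K < z.re} := isOpen_lt continuous_const Complex.continuous_re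
  have hc : ContinuousOn (fun z : ℂ => B * Real.log z.re - |z.im|) {z : ℂ | K < z.re} := by
    refine ContinuousOn.sub (continuousOn_const.mul ?_) (by fun_prop)
    refine Complex.continuous_re.continuousOn.log fun z (hz : K < z.re) => ?_
    linarith
  have := hc.isOpen_inter_preimage h1 isOpen_Ioi (t := Set.Ioi 0)
  convert this using 1
  ext z
  simp [logRegion]

lemma ofReal_mem_logRegion {K B t : ℝ} (hK : 1 ≤ K) (hB : 0 < B) (ht : K < t) :
    (t : ℂ) ∈ logRegion K B := by
  refine ⟨by simpa using ht, ?_⟩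
  have := Real.log_pos (hK.trans_lt ht)
  simpa using by positivity

lemma re_mul_pos {r : ℕ} (hr : 1 ≤ r) {z : ℂ} (hz : 0 < z.re) : 0 < ((r : ℂ) * z).re := by
  have : (0 : ℝ) < r := by exact_mod_cast hr
  rw [← Complex.ofReal_natCast, Complex.re_ofReal_mul]
  positivity

lemma arg_fatouInv {r : ℕ} (hr : 1 ≤ r) {ξ z : ℂ} (hξ : ξ ≠ 0) (hz : 0 < z.re) :
    |(ξ⁻¹ * fatouInv r ξ z).arg| < Real.pi / (2 * r) := by
  have hr' : (0 : ℝ) < r := by exact_mod_cast hr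
  have hr1 : (1 : ℝ) ≤ r := by exact_mod_cast hr
  have h1 := Complex.abs_arg_lt_pi_div_two_iff.2 (Or.inl (re_mul_pos hr hz))
  rw [fatouInv, inv_mul_cancel_left₀ hξ, ← Complex.log_im]
  have him : (-(Complex.log (r * z) / r)).im = -((r * z).arg / r) := by
    rw [Complex.neg_im, Complex.div_natCast_im, Complex.log_im]
  have hb : |(-(Complex.log (r * z) / r)).im| < Real.pi / (2 * r) := by
    rw [him, abs_neg, abs_div, abs_of_pos hr']
    calc _ < Real.pi / 2 / r := by gcongr
      _ = _ := by rw [div_div]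
  have hb' : Real.pi / (2 * r) < Real.pi := by
    rw [div_lt_iff₀ (by positivity)]
    nlinarith [Real.pi_pos]
  have := abs_lt.1 (hb.trans hb')
  rw [Complex.log_exp this.1 this.2.le]
  exact hb

lemma fatou_fatouInv {r : ℕ} (hr : 1 ≤ r) {ξ z : ℂ} (hξ : ξ ^ r = 1) (hz : 0 < z.re) :
    fatou r (fatouInv r ξ z) = z := by
  have hr' : (r : ℂ) ≠ 0 := by exact_mod_cast (by omega : r ≠ 0)
  have hz0 : z ≠ 0 := by rintro rfl; simp at hz
  rw [fatou, fatouInv, mul_pow, hξ, one_mul, ← Complex.exp_nat_mul]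
  have : (r : ℂ) * -(Complex.log (r * z) / r) = -Complex.log (r * z) := by field_simp
  rw [this, Complex.exp_neg, Complex.exp_log (mul_ne_zero hr' hz0)]
  field_simp

/-- The sector condition keeps r·arg(ξ⁻¹x) within the principal range of the logarithm; it selects,
among the r preimages, the one near the direction ξ. -/
lemma fatouInv_fatou {r : ℕ} (hr : 1 ≤ r) {ξ x : ℂ} (hξ : ξ ^ r = 1) (hx : x ≠ 0)
    (harg : |(ξ⁻¹ * x).arg| < Real.pi / (2 * r)) : fatouInv r ξ (fatou r x) = x := by
  have hr' : (r : ℂ) ≠ 0 := by exact_mod_cast (by omega : r ≠ 0)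
  have hrp : (0 : ℝ) < r := by exact_mod_cast hr
  have hξ0 : ξ ≠ 0 := by rintro rfl; simp [show r ≠ 0 by omega] at hξ
  set w := ξ⁻¹ * x with hw
  have hw0 : w ≠ 0 := mul_ne_zero (inv_ne_zero hξ0) hx
  have hxw : x = ξ * w := by rw [hw, mul_inv_cancel_left₀ hξ0]
  have h1 : (r : ℂ) * fatou r x = Complex.exp (-(r * Complex.log w)) := by
    rw [fatou, hxw, mul_pow, hξ, one_mul, Complex.exp_neg, Complex.exp_nat_mul,
      Complex.exp_log hw0]
    field_simp
  have him : (-(r * Complex.log w)).im = -(r * w.arg) := by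
    rw [Complex.neg_im, ← Complex.ofReal_natCast, Complex.im_ofReal_mul, Complex.log_im]
  have hb : |(-(r * Complex.log w)).im| < Real.pi := by
    rw [him, abs_neg, abs_mul, abs_of_pos hrp]
    rw [lt_div_iff₀ (by positivity)] at harg
    nlinarith [Real.pi_pos, abs_nonneg w.arg]
  have hb' := abs_lt.1 hb
  rw [fatouInv, h1, Complex.log_exp hb'.1 hb'.2.le]
  have : -(-(r * Complex.log w) / r) = Complex.log w := by field_simp
  rw [this, Complex.exp_log hw0, ← hxw]

lemma fatouInv_mem_petal {r : ℕ} (hr : 1 ≤ r) {ξ z : ℂ} {K B : ℝ} (hξ : ξ ^ r = 1) (hK : 1 ≤ K)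
    (hz : z ∈ logRegion K B) : fatouInv r ξ z ∈ petal r ξ K B := by
  have hξ0 : ξ ≠ 0 := by rintro rfl; simp [show r ≠ 0 by omega] at hξ
  have hre : 0 < z.re := by linarith [hz.1]
  refine ⟨mul_ne_zero hξ0 (Complex.exp_ne_zero _), arg_fatouInv hr hξ0 hre, ?_⟩
  rwa [fatou_fatouInv hr hξ hre]

lemma continuousOn_fatou (r : ℕ) (hr : 1 ≤ r) : ContinuousOn (fatou r) {x | x ≠ 0} := by
  have hr' : (r : ℂ) ≠ 0 := by exact_mod_cast (by omega : r ≠ 0)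
  unfold fatou
  refine ContinuousOn.div continuousOn_const (by fun_prop) fun x hx => ?_
  exact mul_ne_zero hr' (pow_ne_zero _ hx)

lemma continuousOn_fatouInv {r : ℕ} (hr : 1 ≤ r) (ξ : ℂ) :
    ContinuousOn (fatouInv r ξ) {z | 0 < z.re} := by
  unfold fatouInv
  refine continuousOn_const.mul (ContinuousOn.cexp (ContinuousOn.neg (ContinuousOn.div_const ?_ _)))
  exact ContinuousOn.clog (by fun_prop) fun z hz => Or.inl (re_mul_pos hr hz)

/-- A petal is homeomorphic to a convex set. -/
def petalHomeomorph {r : ℕ} (hr : 1 ≤ r) {ξ : ℂ} (hξ : ξ ^ r = 1) {K B : ℝ} (hK : 1 ≤ K) :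
    petal r ξ K B ≃ₜ logRegion K B where
  toFun x := ⟨fatou r x, x.2.2.2⟩
  invFun z := ⟨fatouInv r ξ z, fatouInv_mem_petal hr hξ hK z.2⟩
  left_inv x := Subtype.ext (fatouInv_fatou hr hξ x.2.1 x.2.2.1)
  right_inv z := Subtype.ext (fatou_fatouInv hr hξ (by linarith [z.2.1]))
  continuous_toFun := by
    refine Continuous.subtype_mk ?_ _
    exact ((continuousOn_fatou r hr).mono fun x hx => hx.1).domRestrict
  continuous_invFun := by
    refine Continuous.subtype_mk ?_ _
    exact ((continuousOn_fatouInv hr ξ).mono fun z hz =>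
      show 0 < z.re by linarith [hz.1]).domRestrict

lemma petal_isSimplyConnected {r : ℕ} (hr : 1 ≤ r) {ξ : ℂ} (hξ : ξ ^ r = 1) {K B : ℝ}
    (hK : 1 ≤ K) (hB : 0 < B) : IsSimplyConnected (petal r ξ K B) := by
  have : ContractibleSpace (logRegion K B) := (logRegion_convex hK hB).contractibleSpace
    ⟨_, ofReal_mem_logRegion hK hB (lt_add_one K)⟩
  have : ContractibleSpace (petal r ξ K B) := (petalHomeomorph hr hξ hK).contractibleSpace
  exact SimplyConnectedSpace.ofContractible _

lemma petal_isOpen {r : ℕ} (hr : 1 ≤ r) {ξ : ℂ} (hξ : ξ ^ r = 1) {K B : ℝ} (hK : 1 ≤ K) :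
    IsOpen (petal r ξ K B) := by
  have hξ0 : ξ ≠ 0 := by rintro rfl; simp [show r ≠ 0 by omega] at hξ
  rw [isOpen_iff_mem_nhds]
  rintro x ⟨hx, harg, hf⟩
  have hr1 : (1 : ℝ) ≤ r := by exact_mod_cast hr
  have hs : ξ⁻¹ * x ∈ Complex.slitPlane := by
    rw [Complex.mem_slitPlane_iff_arg]
    refine ⟨fun h => ?_, mul_ne_zero (inv_ne_zero hξ0) hx⟩
    rw [h, abs_of_pos Real.pi_pos, lt_div_iff₀ (by positivity)] at harg
    nlinarith [Real.pi_pos]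
  have h1 : ContinuousAt (fun x => |(ξ⁻¹ * x).arg|) x :=
    ((Complex.continuousAt_arg hs).comp (f := fun x => ξ⁻¹ * x) (by fun_prop)).abs
  have h2 : ContinuousAt (fatou r) x :=
    (continuousOn_fatou r hr).continuousAt (isOpen_ne.mem_nhds hx)
  filter_upwards [isOpen_ne.mem_nhds hx, h1.eventually (gt_mem_nhds harg),
    h2.eventually_mem ((logRegion_isOpen hK).mem_nhds hf)] with y a b c
  exact ⟨a, b, c⟩

lemma ray_mem_petal {r : ℕ} (hr : 1 ≤ r) {ξ : ℂ} (hξ : ξ ^ r = 1) {K B : ℝ} (hK : 1 ≤ K)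
    (hB : 0 < B) :
    ∃ δ : ℝ, 0 < δ ∧ ∀ t : ℝ, 0 < t → t < δ → ξ * (t : ℂ) ∈ petal r ξ K B := by
  have hξ0 : ξ ≠ 0 := by rintro rfl; simp [show r ≠ 0 by omega] at hξ
  have hr0 : (0 : ℝ) < r := by exact_mod_cast hr
  refine ⟨min 1 (1 / (r * K)), by positivity, fun t ht htδ => ⟨?_, ?_, ?_⟩⟩
  · exact mul_ne_zero hξ0 (by exact_mod_cast ht.ne')
  · rw [inv_mul_cancel_left₀ hξ0, Complex.arg_ofReal_of_nonneg ht.le, abs_zero]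
    have := Real.pi_pos
    positivity
  · have e : fatou r (ξ * t) = ((1 / (r * t ^ r) : ℝ) : ℂ) := by
      rw [fatou, mul_pow, hξ, one_mul]; push_cast; rfl
    rw [e]
    apply ofReal_mem_logRegion hK hB
    have h1 := htδ.trans_le (min_le_left _ _)
    have h2 := htδ.trans_le (min_le_right _ _)
    have h3 : t ^ r ≤ t := by
      calc _ ≤ t ^ 1 := pow_le_pow_of_le_one ht.le h1.le hr
        _ = t := pow_one t
    rw [lt_div_iff₀ (by positivity)] at h2 ⊢
    have : K * (r * t ^ r) ≤ K * (r * t) := by gcongr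
    nlinarith

lemma zero_mem_frontier_petal {r : ℕ} (hr : 1 ≤ r) {ξ : ℂ} (hξ : ξ ^ r = 1) {K B : ℝ}
    (hK : 1 ≤ K) (hB : 0 < B) : (0 : ℂ) ∈ frontier (petal r ξ K B) := by
  rw [(petal_isOpen hr hξ hK).frontier_eq]
  refine ⟨?_, fun h => h.1 rfl⟩
  obtain ⟨δ, hδ, h⟩ := ray_mem_petal hr hξ hK hB
  have ht : Tendsto (fun t : ℝ => ξ * (t : ℂ)) (𝓝[>] 0) (𝓝 0) := by
    have : Continuous fun t : ℝ => ξ * (t : ℂ) := by fun_prop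
    exact (this.tendsto' 0 0 (by simp)).mono_left nhdsWithin_le_nhds
  refine mem_closure_of_tendsto ht ?_
  filter_upwards [Ioo_mem_nhdsGT hδ] with t ht
  exact h t ht.1 ht.2

/-- Factor w^r - |w|^r = (w - |w|) Σ w^i |w|^(r-1-i). In this sector every summand has non-negative
real part, and the one with i = 0 is already |w|^(r-1). -/
lemma norm_sub_norm_mul_le {r : ℕ} (hr : 1 ≤ r) {w : ℂ} (hw : w ≠ 0)
    (harg : |w.arg| < Real.pi / (2 * r)) :
    ‖w - ‖w‖‖ * ‖w‖ ^ (r - 1) ≤ ‖w ^ r - (‖w‖ : ℂ) ^ r‖ := by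
  have hr0 : (0 : ℝ) < r := by exact_mod_cast hr
  rw [← (Commute.all w (‖w‖ : ℂ)).geom_sum₂_mul r, norm_mul, mul_comm]
  refine mul_le_mul_of_nonneg_right ?_ (norm_nonneg _)
  refine le_trans ?_ (Complex.re_le_norm _)
  rw [Complex.re_sum]
  have hterm : ∀ i ∈ Finset.range r, 0 ≤ (w ^ i * (‖w‖ : ℂ) ^ (r - 1 - i)).re := by
    intro i hi
    rw [← Complex.ofReal_pow, Complex.re_mul_ofReal]
    refine mul_nonneg ?_ (by positivity)
    have : w ^ i = Complex.exp (i * Complex.log w) := by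
      rw [Complex.exp_nat_mul, Complex.exp_log hw]
    rw [this, Complex.exp_re]
    refine mul_nonneg (Real.exp_pos _).le ?_
    rw [← Complex.ofReal_natCast, Complex.im_ofReal_mul, Complex.log_im]
    have h1 : |(i : ℝ) * w.arg| ≤ Real.pi / 2 := by
      rw [abs_mul, Nat.abs_cast]
      have hir : (i : ℝ) ≤ r := by exact_mod_cast (Finset.mem_range.1 hi).le
      calc _ ≤ (r : ℝ) * (Real.pi / (2 * r)) := by gcongr
        _ = _ := by field_simp
    exact Real.cos_nonneg_of_mem_Icc (abs_le.1 h1)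
  refine le_trans ?_ (Finset.single_le_sum hterm (Finset.mem_range.2 (show 0 < r by omega)))
  rw [pow_zero, one_mul, Nat.sub_zero, ← Complex.ofReal_pow, Complex.ofReal_re]

/-- On a petal, `x` is close to the direction `ξ`. -/
lemma petal_angle {r : ℕ} (hr : 1 ≤ r) {ξ : ℂ} (hξ : ξ ^ r = 1) {K B : ℝ} (hK : 1 ≤ K)
    {x : ℂ} (hx : x ∈ petal r ξ K B) :
    ‖ξ⁻¹ * x - ‖x‖‖ ≤ ‖x‖ * (2 * B * Real.log (fatou r x).re / (fatou r x).re) := by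
  obtain ⟨hx0, harg, hz1, hz2⟩ := hx
  have hξ0 : ξ ≠ 0 := by rintro rfl; simp [show r ≠ 0 by omega] at hξ
  have hξn : ‖ξ‖ = 1 := Complex.norm_eq_one_of_pow_eq_one hξ (by omega)
  set w := ξ⁻¹ * x with hw
  have hwn : ‖x‖ = ‖w‖ := by rw [hw, norm_mul, norm_inv, hξn, inv_one, one_mul]
  have hw0 : w ≠ 0 := mul_ne_zero (inv_ne_zero hξ0) hx0
  have hwp : 0 < ‖w‖ := norm_pos_iff.2 hw0
  set z := fatou r x with hz
  have hzre : 0 < z.re := by linarith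
  have hz0 : z ≠ 0 := by rintro h; rw [h] at hzre; simp at hzre
  have hr' : (r : ℂ) ≠ 0 := by exact_mod_cast (by omega : r ≠ 0)
  have hwr : w ^ r * (r * z) = 1 := by
    have : w ^ r = x ^ r := by rw [hw, mul_pow, inv_pow, hξ, inv_one, one_mul]
    rw [this, hz, fatou]
    field_simp
  have hnr : (‖w‖ : ℂ) ^ r * (r * ‖z‖) = 1 := by
    have := congrArg norm hwr
    rw [norm_mul, norm_mul, norm_pow, Complex.norm_natCast, norm_one] at this
    exact_mod_cast this
  have key := norm_sub_norm_mul_le hr hw0 harg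
  -- w^r = 1/(rz) and |w|^r = 1/(r|z|), so the deviation of w^r from the ray is that of z, which is
  -- at most 2|Im z|.
  have e : w ^ r - (‖w‖ : ℂ) ^ r = (‖w‖ : ℂ) ^ r * ((‖z‖ - z) / z) := by
    have h1 : w ^ r * z = (‖w‖ : ℂ) ^ r * ‖z‖ := by
      have h2 : w ^ r * (r * z) = (‖w‖ : ℂ) ^ r * (r * ‖z‖) := by rw [hwr, hnr]
      apply mul_left_cancel₀ hr'
      linear_combination h2
    field_simp
    linear_combination h1
  clear_value w
  rw [e, norm_mul, norm_div, norm_pow, Complex.norm_real, norm_norm] at key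
  have hzz : ‖(‖z‖ : ℂ) - z‖ ≤ 2 * |z.im| := by
    have h1 := Complex.norm_le_abs_re_add_abs_im ((‖z‖ : ℂ) - z)
    have h2 := Complex.norm_le_abs_re_add_abs_im z
    have h3 := Complex.re_le_norm z
    rw [Complex.sub_re, Complex.sub_im, Complex.ofReal_re, Complex.ofReal_im, zero_sub, abs_neg,
      abs_of_nonneg (by linarith)] at h1
    rw [abs_of_pos hzre] at h2
    linarith
  have hq : ‖(‖z‖ : ℂ) - z‖ / ‖z‖ ≤ 2 * B * Real.log z.re / z.re := by
    apply div_le_div₀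
    · have : 0 ≤ B * Real.log z.re := (abs_nonneg _).trans hz2.le
      linarith
    · linarith
    · exact hzre
    · exact Complex.re_le_norm z
  rw [hwn]
  have hpow : ‖w‖ ^ r = ‖w‖ * ‖w‖ ^ (r - 1) := by
    rw [← pow_succ']
    congr 1
    omega
  rw [hpow] at key
  have hk2 : ‖w - ‖w‖‖ * ‖w‖ ^ (r - 1) ≤
      ‖w‖ * (2 * B * Real.log z.re / z.re) * ‖w‖ ^ (r - 1) := by
    calc _ ≤ _ := key
      _ = ‖w‖ * (‖(‖z‖ : ℂ) - z‖ / ‖z‖) * ‖w‖ ^ (r - 1) := by ring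
      _ ≤ _ := by gcongr
  exact le_of_mul_le_mul_right hk2 (by positivity)

end Petal

/-! ### Invariance of the petals and of the neighbourhoods of the curve -/

section Dynamics

lemma norm_pow_le_inv_re {r : ℕ} (hr : 1 ≤ r) {x : ℂ} (h : 0 < (fatou r x).re) :
    ‖x‖ ^ r ≤ 1 / (fatou r x).re := by
  have hr1 : (1 : ℝ) ≤ r := by exact_mod_cast hr
  have hx : x ≠ 0 := by
    rintro rfl
    simp [fatou, show r ≠ 0 by omega] at h
  have hx0 : 0 < ‖x‖ ^ r := pow_pos (norm_pos_iff.2 hx) r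
  have h1 := Complex.re_le_norm (fatou r x)
  rw [norm_fatou] at h1
  rw [le_div_iff₀ h]
  calc _ ≤ ‖x‖ ^ r * (1 / (r * ‖x‖ ^ r)) := by gcongr
    _ = 1 / r := by field_simp
    _ ≤ 1 := by rw [div_le_one (by positivity)]; exact hr1

/-- Deep inside a petal, points are small and close to the direction `ξ`. -/
lemma petal_small {r p : ℕ} (hr : 1 ≤ r) (hp : p + 1 ≤ r) {ξ : ℂ} (hξ : ξ ^ r = 1) {B ε : ℝ}
    (hB : 0 < B) (hε : 0 < ε) :
    ∀ᶠ K in atTop, ∀ x ∈ petal r ξ K B, ‖x‖ < ε ∧ ‖ξ⁻¹ * x - ‖x‖‖ ≤ ε * ‖x‖ ∧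
      ‖ξ⁻¹ * x - ‖x‖‖ ≤ ‖x‖ ^ (p + 1) := by
  have e1 : ∀ᶠ X : ℝ in atTop, 1 / ε ^ r < X := eventually_gt_atTop _
  have e1' : ∀ᶠ X : ℝ in atTop, 1 < X := eventually_gt_atTop _
  have hlog : ∀ c : ℝ, 0 < c → ∀ᶠ X : ℝ in atTop, Real.log X ≤ c * X := by
    intro c hc
    filter_upwards [Real.isLittleO_log_id_atTop.bound hc, eventually_gt_atTop 0] with X hX hX0
    rw [id, Real.norm_of_nonneg hX0.le] at hX
    exact (le_abs_self _).trans hX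
  have e2 := hlog (ε / (2 * B)) (by positivity)
  have e3 := hlog (1 / B) (by positivity)
  -- With |x|^r ≤ 1/X this gives 4rB·log X·|x| ≤ 1: one factor |x| absorbs the logarithm, and the
  -- deviation is at most |x|^r ≤ |x|^(p+1).
  have e4 : ∀ᶠ X : ℝ in atTop, (4 * r * B * Real.log X) ^ r ≤ X := by
    filter_upwards [(Real.isLittleO_pow_log_id_atTop (n := r)).bound
      (show 0 < ((4 * r * B) ^ r)⁻¹ by positivity), eventually_gt_atTop 0] with X hX hX0
    rw [id, Real.norm_of_nonneg hX0.le] at hX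
    rw [mul_pow]
    have := (le_abs_self _).trans hX
    rwa [le_inv_mul_iff₀ (by positivity)] at this
  have hall := (e1.and (e1'.and (e2.and (e3.and e4))))
  filter_upwards [eventually_forall_ge_atTop.2 hall, eventually_ge_atTop 1] with K hK hK1 x hx
  have hX := hx.2.2.1
  obtain ⟨h1, h1', h2, h3, h4⟩ := hK _ hX.le
  have hang := petal_angle hr hξ hK1 hx
  set X := (fatou r x).re with hXdef
  have hX0 : 0 < X := by linarith
  have hpow := norm_pow_le_inv_re hr hX0
  rw [← hXdef] at hpow
  have hxp : 0 < ‖x‖ := norm_pos_iff.2 hx.1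
  have hr0 : (0 : ℝ) < r := by exact_mod_cast hr
  have hlog0 : 0 ≤ Real.log X := Real.log_nonneg h1'.le
  have hxε : ‖x‖ < ε := by
    apply lt_of_pow_lt_pow_left₀ r hε.le
    refine hpow.trans_lt ?_
    rw [div_lt_iff₀ (by positivity)] at h1 ⊢
    linarith
  have hx1 : ‖x‖ < 1 := by
    apply lt_of_pow_lt_pow_left₀ r one_pos.le
    refine hpow.trans_lt ?_
    rw [one_pow, div_lt_iff₀ hX0]
    linarith
  refine ⟨hxε, ?_, ?_⟩
  · refine hang.trans ?_
    rw [mul_comm]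
    refine mul_le_mul_of_nonneg_right ?_ hxp.le
    rw [div_le_iff₀ hX0]
    calc _ ≤ 2 * B * (ε / (2 * B) * X) := by gcongr
      _ = _ := by field_simp
  · refine hang.trans ?_
    have hz : ‖fatou r x‖ ≤ 2 * X := by
      have := Complex.norm_le_abs_re_add_abs_im (fatou r x)
      have h5 := hx.2.2.2
      rw [← hXdef, abs_of_pos hX0] at this
      rw [← hXdef] at h5
      have h6 : B * Real.log X ≤ X := by
        calc _ ≤ B * (1 / B * X) := by gcongr
          _ = X := by field_simp
      linarith
    have h5 : 4 * r * B * Real.log X * ‖x‖ ≤ 1 := by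
      refine (pow_le_one_iff_of_nonneg (by positivity) (show r ≠ 0 by omega)).1 ?_
      rw [mul_pow]
      calc _ ≤ X * (1 / X) := by gcongr
        _ = 1 := by field_simp
    rw [norm_fatou, div_le_iff₀ (by positivity)] at hz
    have h6 : 2 * B * Real.log X / X * ‖x‖ ≤ ‖x‖ ^ r := by
      rw [div_mul_eq_mul_div, div_le_iff₀ hX0]
      have : 2 * B * Real.log X * ‖x‖ ≤ 1 / (2 * r) := by
        rw [le_div_iff₀ (by positivity)]
        linarith
      refine this.trans ?_
      rw [div_le_iff₀ (by positivity)]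
      linarith
    calc _ = 2 * B * Real.log X / X * ‖x‖ := by ring
      _ ≤ ‖x‖ ^ r := h6
      _ ≤ ‖x‖ ^ (p + 1) := pow_le_pow_of_le_one hxp.le hx1.le hp

/-- The imaginary part moves by at most C/X, with X = Re z, while log X grows by at least 1/(4X);
hence the constant 4C. -/
lemma log_step {C : ℝ} (hC : 0 < C) {z z₁ : ℂ} (h1 : 1 ≤ z.re) (h2 : 2 * C ≤ z.re)
    (h : ‖z₁ - z - 1‖ ≤ C / z.re) :
    z.re + 1 / 2 ≤ z₁.re ∧ |z₁.im| - |z.im| ≤ 4 * C * (Real.log z₁.re - Real.log z.re) := by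
  have hX : 0 < z.re := by linarith
  have hre := (Complex.abs_re_le_norm _).trans h
  have him := (Complex.abs_im_le_norm _).trans h
  simp only [Complex.sub_re, Complex.sub_im, Complex.one_re, Complex.one_im, sub_zero] at hre him
  have hC2 : C / z.re ≤ 1 / 2 := by
    rw [div_le_iff₀ hX]; linarith
  have hr : z.re + 1 / 2 ≤ z₁.re := by
    have := (abs_le.1 hre).1
    linarith
  refine ⟨hr, ?_⟩
  have hi : |z₁.im| - |z.im| ≤ C / z.re := (abs_sub_abs_le_abs_sub _ _).trans him
  have hl : 1 / (4 * z.re) ≤ Real.log z₁.re - Real.log z.re := by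
    have h3 : Real.log (z.re + 1 / 2) ≤ Real.log z₁.re := Real.log_le_log (by linarith) hr
    have h4 := Real.one_sub_inv_le_log_of_pos (x := (z.re + 1 / 2) / z.re) (by positivity)
    rw [Real.log_div (by positivity) hX.ne', inv_div] at h4
    have h5 : 1 / (4 * z.re) ≤ 1 - z.re / (z.re + 1 / 2) := by
      rw [one_sub_div (by positivity), div_le_div_iff₀ (by positivity) (by positivity)]
      linarith
    linarith
  calc _ ≤ _ := hi
    _ = 4 * C * (1 / (4 * z.re)) := by field_simp
    _ ≤ _ := by gcongr

lemma logRegion_step {C K B : ℝ} (hC : 0 < C) (hB : 4 * C ≤ B) (hK : 1 ≤ K) (hK2 : 2 * C ≤ K)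
    {z z₁ : ℂ} (hz : z ∈ logRegion K B) (h : ‖z₁ - z - 1‖ ≤ C / z.re) :
    z₁ ∈ logRegion K B ∧ z.re + 1 / 2 ≤ z₁.re := by
  obtain ⟨hz1, hz2⟩ := hz
  obtain ⟨h1, h2⟩ := log_step hC (by linarith) (by linarith) h
  refine ⟨⟨by linarith, ?_⟩, h1⟩
  have h3 : 0 ≤ Real.log z₁.re - Real.log z.re :=
    sub_nonneg.2 (Real.log_le_log (by linarith) (by linarith))
  have := mul_le_mul_of_nonneg_right hB h3
  linarith

/-- |Im z| - 4C log Re z is eventually non-increasing, while (B - 4C) log Re z → ∞; this needs B >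
4C strictly. -/
lemma eventually_mem_logRegion {C K B : ℝ} (hC : 0 < C) (hB : 4 * C < B) {z : ℕ → ℂ}
    (hz : Tendsto (fun n => (z n).re) atTop atTop)
    (h : ∀ᶠ n in atTop, ‖z (n + 1) - z n - 1‖ ≤ C / (z n).re) :
    ∀ᶠ n in atTop, z n ∈ logRegion K B := by
  obtain ⟨N, hN⟩ := eventually_atTop.1
    (h.and ((hz.eventually_ge_atTop 1).and (hz.eventually_ge_atTop (2 * C))))
  have hmono : ∀ n ≥ N, |(z n).im| - 4 * C * Real.log (z n).re ≤
      |(z N).im| - 4 * C * Real.log (z N).re := by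
    intro n hn
    induction n, hn using Nat.le_induction with
    | base => exact le_rfl
    | succ n hn ih =>
      obtain ⟨a, b, c⟩ := hN n hn
      have := (log_step hC b c a).2
      linarith
  have hlog : Tendsto (fun n => (B - 4 * C) * Real.log (z n).re) atTop atTop :=
    (Real.tendsto_log_atTop.comp hz).const_mul_atTop (by linarith)
  filter_upwards [eventually_ge_atTop N, hz.eventually_gt_atTop K,
    hlog.eventually_gt_atTop (|(z N).im| - 4 * C * Real.log (z N).re)] with n h1 h2 h3
  refine ⟨h2, ?_⟩
  have := hmono n h1
  linarith

/-- Continuity of the argument at 1, made homogeneous by dividing by |w|. -/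
lemma exists_sector (r : ℕ) (hr : 1 ≤ r) :
    ∃ η > 0, ∀ w : ℂ, w ≠ 0 → ‖w - ‖w‖‖ ≤ η * ‖w‖ → |w.arg| < Real.pi / (2 * r) := by
  have hr0 : (0 : ℝ) < r := by exact_mod_cast hr
  have hc : ContinuousAt (fun w : ℂ => |w.arg|) 1 :=
    (Complex.continuousAt_arg (by simp [Complex.slitPlane])).abs
  have hpos : |(1 : ℂ).arg| < Real.pi / (2 * r) := by
    have := Real.pi_pos
    simp only [Complex.arg_one, abs_zero]
    positivity
  obtain ⟨η, hη, h⟩ := Metric.eventually_nhds_iff_ball.1 (hc.eventually (gt_mem_nhds hpos))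
  refine ⟨η / 2, by positivity, fun w hw hwη => ?_⟩
  have hwp : 0 < ‖w‖ := norm_pos_iff.2 hw
  have hwc : (‖w‖ : ℂ) ≠ 0 := by exact_mod_cast hwp.ne'
  have e : ((‖w‖⁻¹ : ℝ) : ℂ) * w - 1 = ((‖w‖⁻¹ : ℝ) : ℂ) * (w - ‖w‖) := by
    push_cast
    field_simp
  have h1 := h (((‖w‖⁻¹ : ℝ) : ℂ) * w) (by
    rw [Metric.mem_ball, dist_eq_norm, e, norm_mul, Complex.norm_real, norm_inv, norm_norm,
      inv_mul_lt_iff₀ hwp]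
    nlinarith)
  rwa [Complex.arg_real_mul _ (inv_pos.2 hwp)] at h1

/-- The Fatou coordinate does not distinguish the r sectors; the bound on x₁ - x ensures that x₁
stays in the sector of x. -/
lemma petal_step {r : ℕ} (hr : 1 ≤ r) {ξ : ℂ} (hξ : ξ ^ r = 1) {C : ℝ}
    (hC : 0 < C) {B : ℝ} (hB : 4 * C ≤ B) :
    ∀ᶠ K in atTop, ∀ x ∈ petal r ξ K B, ∀ x₁,
      ‖fatou r x₁ - fatou r x - 1‖ ≤ C * ‖x‖ ^ r → ‖x₁ - x‖ ≤ C * ‖x‖ ^ (r + 1) →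
      x₁ ∈ petal r ξ K B ∧ (fatou r x).re + 1 / 2 ≤ (fatou r x₁).re := by
  obtain ⟨η, hη, hsec⟩ := exists_sector r hr
  have hξ0 : ξ ≠ 0 := by rintro rfl; simp [show r ≠ 0 by omega] at hξ
  have hξn : ‖ξ‖ = 1 := Complex.norm_eq_one_of_pow_eq_one hξ (by omega)
  -- The second bound gives |x₁| ≥ |x|/2; the third gives 2|x₁ - x| + ε|x| ≤ η|x|/2 ≤ η|x₁|, as
  -- required by `exists_sector`.
  set ε := min 1 (min (1 / (2 * C)) (η / (2 * (2 * C + 1)))) with hε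
  have hε0 : 0 < ε := by positivity
  filter_upwards [petal_small (p := 0) (B := B) hr hr hξ (by linarith) hε0, eventually_ge_atTop 1,
    eventually_ge_atTop (2 * C)] with K hsm hK1 hK2 x hx x₁ hf hd
  obtain ⟨h1, h2, -⟩ := hsm x hx
  have hxp : 0 < ‖x‖ := norm_pos_iff.2 hx.1
  have hX : 0 < (fatou r x).re := by linarith [hx.2.2.1]
  have hstep := logRegion_step hC hB hK1 hK2 hx.2.2 (hf.trans (by
    rw [div_eq_mul_one_div]
    exact mul_le_mul_of_nonneg_left (norm_pow_le_inv_re hr hX) hC.le))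
  have hε1 : ε ≤ 1 := min_le_left _ _
  have hε2 : ε ≤ 1 / (2 * C) := (min_le_right _ _).trans (min_le_left _ _)
  have hε3 : ε ≤ η / (2 * (2 * C + 1)) := (min_le_right _ _).trans (min_le_right _ _)
  have hpr : ‖x‖ ^ r ≤ ε := by
    calc _ ≤ ‖x‖ ^ 1 := pow_le_pow_of_le_one hxp.le (h1.le.trans hε1) hr
      _ = ‖x‖ := pow_one _
      _ ≤ ε := h1.le
  have hd' : ‖x₁ - x‖ ≤ C * ε * ‖x‖ := by
    calc _ ≤ _ := hd
      _ = C * ‖x‖ ^ r * ‖x‖ := by ring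
      _ ≤ _ := by gcongr
  have hCε : C * ε ≤ 1 / 2 := by
    rw [le_div_iff₀ (by positivity)] at hε2
    linarith
  have hηε : (2 * C + 1) * ε ≤ η / 2 := by
    rw [le_div_iff₀ (by positivity)] at hε3
    linarith
  have hx1 : ‖x‖ / 2 ≤ ‖x₁‖ := by
    have h3 := norm_sub_norm_le x x₁
    rw [norm_sub_rev] at h3
    have := mul_le_mul_of_nonneg_right hCε hxp.le
    linarith
  have hx₁ : x₁ ≠ 0 := norm_pos_iff.1 (by linarith)
  refine ⟨⟨hx₁, ?_, hstep.1⟩, hstep.2⟩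
  apply hsec _ (mul_ne_zero (inv_ne_zero hξ0) hx₁)
  have hn : ‖ξ⁻¹ * x₁‖ = ‖x₁‖ := by rw [norm_mul, norm_inv, hξn, inv_one, one_mul]
  rw [hn]
  have e : ξ⁻¹ * x₁ - ‖x₁‖ = ξ⁻¹ * (x₁ - x) + (ξ⁻¹ * x - ‖x‖) + ((‖x‖ - ‖x₁‖ : ℝ) : ℂ) := by
    push_cast; ring
  rw [e]
  have n1 := norm_add₃_le (a := ξ⁻¹ * (x₁ - x)) (b := ξ⁻¹ * x - ‖x‖)
    (c := ((‖x‖ - ‖x₁‖ : ℝ) : ℂ))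
  have n2 : ‖ξ⁻¹ * (x₁ - x)‖ = ‖x₁ - x‖ := by rw [norm_mul, norm_inv, hξn, inv_one, one_mul]
  have n3 : ‖((‖x‖ - ‖x₁‖ : ℝ) : ℂ)‖ ≤ ‖x₁ - x‖ := by
    rw [Complex.norm_real, norm_sub_rev x₁ x]
    exact abs_norm_sub_norm_le _ _
  have n4 := mul_le_mul_of_nonneg_right hηε hxp.le
  have n5 := mul_le_mul_of_nonneg_left hx1 hη.le
  linarith

/-- The domain `|y - J(x)| < W |x| ^ q`, where `J` is the jet of order `q + r` of the invariant
curve, is mapped into itself. -/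
lemma transverse_step {F : ℂ × ℂ → ℂ × ℂ} {Γ : FormalCurve} {k p : ℕ} {μ : ℂ}
    {a : Polynomial ℂ} {g : PowerSeries ℂ} {ξ : ℂ} (hF0 : F 0 = 0) (hF : AnalyticAt ℂ F 0)
    (hΓ : Γ.IsInvariant F) (hred : IsReducedForm F Γ k p μ a)
    (h : Γ.IsParametrization (PowerSeries.X, g)) (hξ : ‖ξ‖ = 1)
    (hnode : IsNodeDirection k p μ a ξ) {C : ℝ} (hC : 0 < C) (q : ℕ) :
    ∀ᶠ z : ℂ × ℂ in 𝓝 0, z.1 ≠ 0 → ‖ξ⁻¹ * z.1 - ‖z.1‖‖ ≤ ‖z.1‖ ^ (p + 1) →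
      ‖(F z).1 - z.1‖ ≤ C * ‖z.1‖ ^ (k + p + 1) → ∀ W : ℝ, 1 ≤ W →
      ‖z.2 - (PowerSeries.trunc (q + (k + p) + 1) g).eval z.1‖ ≤ W * ‖z.1‖ ^ q →
      ‖(F z).2 - (PowerSeries.trunc (q + (k + p) + 1) g).eval (F z).1‖ < W * ‖(F z).1‖ ^ q := by
  have hξ0 : ξ ≠ 0 := by rintro rfl; simp at hξ
  obtain ⟨D, hD, hv⟩ := transverse_bound hF0 hF hΓ hred h (n := q + (k + p) + 1) (by omega)
  obtain ⟨c, hc, hn⟩ := node_bound hred.one_le hξ hnode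
  have hx : Tendsto (fun z : ℂ × ℂ => z.1) (𝓝 0) (𝓝 0) := continuous_fst.tendsto' _ _ rfl
  have hw : Tendsto (fun z : ℂ × ℂ => ξ⁻¹ * z.1) (𝓝 0) (𝓝 0) := by
    simpa using hx.const_mul ξ⁻¹
  have hsmall : ∀ ε > (0 : ℝ), ∀ᶠ z : ℂ × ℂ in 𝓝 0, ‖z.1‖ < ε := fun ε hε =>
    hx.norm.eventually (gt_mem_nhds (by simpa using hε))
  filter_upwards [hv, hw.eventually hn, hsmall 1 one_pos, hsmall (1 / C) (by positivity),
    hsmall (c / (2 * D + q * C)) (by positivity)] with z hv hn h1 h2 h3 hx0 hang hd W hW hle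
  set J := PowerSeries.trunc (q + (k + p) + 1) g
  set s := ‖z.1‖ with hs
  have hs0 : 0 < s := norm_pos_iff.2 hx0
  have hwn : ‖ξ⁻¹ * z.1‖ = s := by rw [norm_mul, norm_inv, hξ, inv_one, one_mul]
  have hn' := hn (mul_ne_zero (inv_ne_zero hξ0) hx0) (by rw [hwn]; exact hang)
  rw [mul_inv_cancel_left₀ hξ0, hwn] at hn'
  have hk := hred.one_le
  have hW0 : 0 < W := by linarith
  -- W ≥ 1 absorbs the defect of the jet into the multiplier, so the neighbourhood of 0 does not
  -- depend on W.
  have b1 : ‖(F z).2 - J.eval (F z).1‖ ≤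
      W * s ^ q * (1 - c * s ^ (k + p - 1) + 2 * D * s ^ (k + p + 1)) := by
    have f0 : 0 ≤ 1 - c * s ^ (k + p - 1) + D * s ^ (k + p + 1) := by
      have := (norm_nonneg _).trans hn'
      positivity
    calc _ ≤ _ := hv
      _ ≤ W * s ^ q * (1 - c * s ^ (k + p - 1) + D * s ^ (k + p + 1)) +
          W * (D * s ^ (q + (k + p) + 1)) := by
        refine add_le_add ?_ ?_
        · exact mul_le_mul hle (by linarith) (by positivity) (by positivity)
        · exact le_mul_of_one_le_left (by positivity) hW
      _ = _ := by ring
  have hCs : C * s ^ (k + p) ≤ 1 := by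
    have : s ^ (k + p) ≤ s := by
      calc _ ≤ s ^ 1 := pow_le_pow_of_le_one hs0.le h1.le (by omega)
        _ = s := pow_one s
    rw [lt_div_iff₀ hC] at h2
    nlinarith
  have b2 : s * (1 - C * s ^ (k + p)) ≤ ‖(F z).1‖ := by
    have h4 := norm_sub_norm_le z.1 (F z).1
    rw [norm_sub_rev] at h4
    have : C * s ^ (k + p + 1) = s * (C * s ^ (k + p)) := by ring
    linarith
  have b3 : s ^ q * (1 - q * (C * s ^ (k + p))) ≤ ‖(F z).1‖ ^ q := by
    have h4 := one_add_mul_le_pow (a := -(C * s ^ (k + p))) (by linarith) q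
    calc _ = s ^ q * (1 + q * -(C * s ^ (k + p))) := by ring
      _ ≤ s ^ q * (1 + -(C * s ^ (k + p))) ^ q := by gcongr
      _ = (s * (1 - C * s ^ (k + p))) ^ q := by rw [mul_pow]; ring
      _ ≤ _ := by
        refine pow_le_pow_left₀ ?_ b2 q
        exact mul_nonneg hs0.le (by linarith)
  refine b1.trans_lt ?_
  refine lt_of_lt_of_le ?_ (mul_le_mul_of_nonneg_left b3 hW0.le)
  rw [← mul_assoc]
  refine mul_lt_mul_of_pos_left ?_ (by positivity)
  -- It remains to compare the gain c s^m with losses of at most (2D + qC) s^(m+1).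
  obtain ⟨m, hm⟩ : ∃ m, k + p = m + 1 := ⟨k + p - 1, by omega⟩
  rw [hm, Nat.add_sub_cancel]
  have h5 : (2 * D + q * C) * s < c := by
    rw [lt_div_iff₀ (by positivity)] at h3
    linarith
  have h6 : D * s ^ (m + 1 + 1) ≤ D * (s * s ^ m) := by
    have : s ^ (m + 1 + 1) ≤ s ^ (m + 1) := pow_le_pow_of_le_one hs0.le h1.le (by omega)
    calc _ ≤ D * s ^ (m + 1) := by gcongr
      _ = _ := by ring
  have h7 := mul_lt_mul_of_pos_right h5 (pow_pos hs0 m)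
  have h8 : s ^ (m + 1) = s * s ^ m := by ring
  rw [h8]
  linarith

end Dynamics

/-! ### Iterated tangents and flat contact -/

section BlowUps

lemma FormalCurve.IsParametrization.constantCoeff_graph {Γ : FormalCurve} {g : PowerSeries ℂ}
    (h : Γ.IsParametrization (PowerSeries.X, g)) : PowerSeries.constantCoeff g = 0 :=
  h.constantCoeff_snd

/-- The series `∑_{m ≥ 1} c_{n + m} X ^ m`, where the `c_m` are the coefficients of `g`. -/
def tailSeries (g : PowerSeries ℂ) (n : ℕ) : PowerSeries ℂ :=
  PowerSeries.mk fun m => if m = 0 then 0 else PowerSeries.coeff (n + m) g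

lemma constantCoeff_tailSeries (g : PowerSeries ℂ) (n : ℕ) :
    PowerSeries.constantCoeff (tailSeries g n) = 0 := by
  rw [← PowerSeries.coeff_zero_eq_constantCoeff_apply, tailSeries, PowerSeries.coeff_mk, if_pos rfl]

lemma tailSeries_zero {g : PowerSeries ℂ} (hg : PowerSeries.constantCoeff g = 0) :
    tailSeries g 0 = g := by
  ext m
  rw [tailSeries, PowerSeries.coeff_mk, zero_add]
  split_ifs with h
  · rw [h, PowerSeries.coeff_zero_eq_constantCoeff_apply, hg]
  · rfl

/-- This is one blow-down in the second coordinate: each blow-up strips one coefficient of g, which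
is the slope of the centre. -/
lemma tailSeries_eq (g : PowerSeries ℂ) (n : ℕ) :
    tailSeries g n = PowerSeries.X * (tailSeries g (n + 1) +
      algebraMap ℂ (PowerSeries ℂ) (PowerSeries.coeff (n + 1) g)) := by
  ext m
  cases m with
  | zero => simp [constantCoeff_tailSeries]
  | succ m =>
    rw [PowerSeries.coeff_succ_X_mul, map_add]
    simp only [tailSeries, PowerSeries.coeff_mk, PowerSeries.algebraMap_apply,
      Algebra.algebraMap_self, RingHom.id_apply, PowerSeries.coeff_C]
    by_cases hm : m = 0
    · simp [hm]
    · simp only [hm, if_false, Nat.succ_ne_zero, add_zero]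
      rw [show n + (m + 1) = n + 1 + m by ring]

lemma FormalCurve.IsParametrization.isInfinitelyNear {Γ : FormalCurve} {g : PowerSeries ℂ}
    (h : Γ.IsParametrization (PowerSeries.X, g)) :
    Γ.IsInfinitelyNear fun n => OnePoint.some (PowerSeries.coeff (n + 1) g) := by
  refine ⟨fun n => (PowerSeries.X, tailSeries g n), ?_, fun n => ⟨?_, ?_, ?_⟩⟩
  · simp only [tailSeries_zero h.constantCoeff_graph]
    exact h
  · simp only [blowDown]
    rw [tailSeries_eq g n]
  · exact PowerSeries.constantCoeff_X
  · exact constantCoeff_tailSeries _ _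

/-- Any parametrization is (u, g(u)) with u ≠ 0, and cancelling u at each blow-up forces the lifts
to be (u, tail(u)). The constant terms then determine the centres. -/
lemma FormalCurve.IsInfinitelyNear.eq {Γ : FormalCurve} {g : PowerSeries ℂ}
    (h : Γ.IsParametrization (PowerSeries.X, g)) {q : ℕ → OnePoint ℂ} (hq : Γ.IsInfinitelyNear q)
    (n : ℕ) : q n = OnePoint.some (PowerSeries.coeff (n + 1) g) := by
  obtain ⟨G, hG0, hG⟩ := hq
  set u := (G 0).1 with hu
  have hu0 : PowerSeries.constantCoeff u = 0 := hG0.constantCoeff_fst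
  have hs : PowerSeries.HasSubst u := PowerSeries.HasSubst.of_constantCoeff_zero' hu0
  have hne : u ≠ 0 := by
    intro h0
    apply hG0.ne_zero
    have h2 := h.snd_eq_subst hG0
    rw [← hu, h0] at h2
    rw [PowerSeries.subst_zero_of_constantCoeff_zero h.constantCoeff_graph] at h2
    exact Prod.ext h0 h2
  have htail : ∀ n, PowerSeries.subst u (tailSeries g n) = u *
      (PowerSeries.subst u (tailSeries g (n + 1)) +
        algebraMap ℂ (PowerSeries ℂ) (PowerSeries.coeff (n + 1) g)) := by
    intro n
    conv_lhs => rw [tailSeries_eq]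
    rw [← PowerSeries.coe_substAlgHom hs, map_mul, map_add, AlgHom.commutes,
      PowerSeries.substAlgHom_X]
  have step : ∀ n, G n = (u, PowerSeries.subst u (tailSeries g n)) →
      q n = OnePoint.some (PowerSeries.coeff (n + 1) g) ∧
        G (n + 1) = (u, PowerSeries.subst u (tailSeries g (n + 1))) := by
    intro n hn
    obtain ⟨h1, h2, h3⟩ := hG n
    rw [hn] at h1
    have hc : PowerSeries.constantCoeff (PowerSeries.subst u (tailSeries g (n + 1)) :
        PowerSeries ℂ) = 0 :=
      PowerSeries.constantCoeff_subst_eq_zero hu0 _ (constantCoeff_tailSeries g (n + 1))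
    generalize hw : G (n + 1) = w at h1 h2 h3
    obtain ⟨w1, w2⟩ := w
    cases hqn : q n with
    -- A centre at infinity would give 1 = w1·v with w1 without constant term.
    | infty =>
      exfalso
      rw [hqn] at h1
      have e1 : w1 * w2 = u := congrArg Prod.fst h1
      have e2 : w2 = PowerSeries.subst u (tailSeries g n) := congrArg Prod.snd h1
      rw [htail, ← e1] at e2
      have hw2 : w2 ≠ 0 := by
        rintro rfl
        exact hne (by rw [← e1, mul_zero])
      set v : PowerSeries ℂ := PowerSeries.subst (w1 * w2) (tailSeries g (n + 1)) +
        algebraMap ℂ (PowerSeries ℂ) (PowerSeries.coeff (n + 1) g) with hv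
      have e3 : w2 * 1 = w2 * (w1 * v) := by
        rw [mul_one]
        calc w2 = w1 * w2 * v := e2
          _ = _ := by ring
      have e4 := congrArg PowerSeries.constantCoeff (mul_left_cancel₀ hw2 e3)
      have h2' : PowerSeries.constantCoeff w1 = 0 := h2
      rw [map_mul, h2', zero_mul, map_one] at e4
      exact one_ne_zero e4
    | coe t =>
      rw [hqn] at h1
      have e1 : w1 = u := congrArg Prod.fst h1
      have e2 : w1 * (w2 + algebraMap ℂ (PowerSeries ℂ) t) =
        PowerSeries.subst u (tailSeries g n) := congrArg Prod.snd h1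
      rw [htail, e1] at e2
      have e3 := mul_left_cancel₀ hne e2
      have h3' : PowerSeries.constantCoeff w2 = 0 := h3
      have e4 := congrArg PowerSeries.constantCoeff e3
      rw [map_add, map_add, h3', hc, zero_add, zero_add, PowerSeries.algebraMap_apply,
        PowerSeries.algebraMap_apply, PowerSeries.constantCoeff_C, PowerSeries.constantCoeff_C] at e4
      have e5 : t = PowerSeries.coeff (n + 1) g := e4
      refine ⟨by rw [e5], ?_⟩
      rw [e5] at e3
      rw [e1, add_right_cancel e3]
  have all : ∀ n, G n = (u, PowerSeries.subst u (tailSeries g n)) := by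
    intro n
    induction n with
    | zero =>
      rw [tailSeries_zero h.constantCoeff_graph, hu, ← h.snd_eq_subst hG0]
    | succ n ih => exact (step n ih).2
  exact (step n (all n)).1

lemma eval_trunc_succ (g : PowerSeries ℂ) (n : ℕ) (x : ℂ) :
    (PowerSeries.trunc (n + 1) g).eval x =
      (PowerSeries.trunc n g).eval x + PowerSeries.coeff n g * x ^ n := by
  rw [PowerSeries.trunc_succ, Polynomial.eval_add, Polynomial.eval_monomial]

/-- The n blow-downs compose to (x, y) ↦ (x, x^n y + J_n g(x)). -/
lemma mem_liftedSet_iff {g : PowerSeries ℂ} (hg : PowerSeries.constantCoeff g = 0)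
    (S : Set (ℂ × ℂ)) (n : ℕ) (w : ℂ × ℂ) :
    w ∈ liftedSet (fun n => OnePoint.some (PowerSeries.coeff (n + 1) g)) S n ↔
      (w.1, w.1 ^ n * w.2 + (PowerSeries.trunc (n + 1) g).eval w.1) ∈ S := by
  induction n generalizing w with
  | zero =>
    have : (PowerSeries.trunc 1 g).eval w.1 = 0 := by
      rw [eval_trunc_succ, PowerSeries.coeff_zero_eq_constantCoeff_apply, hg]
      simp
    simp only [liftedSet, pow_zero, one_mul, zero_add, this, add_zero]
  | succ n ih =>
    rw [liftedSet, Set.mem_preimage, ih]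
    have : blowDown (OnePoint.some (PowerSeries.coeff (n + 1) g)) w =
        (w.1, w.1 * (w.2 + PowerSeries.coeff (n + 1) g)) := rfl
    rw [this, eval_trunc_succ g (n + 1)]
    have e : w.1 ^ n * (w.1 * (w.2 + PowerSeries.coeff (n + 1) g)) +
        (PowerSeries.trunc (n + 1) g).eval w.1 = w.1 ^ (n + 1) * w.2 +
        ((PowerSeries.trunc (n + 1) g).eval w.1 + PowerSeries.coeff (n + 1) g * w.1 ^ (n + 1)) := by
      ring
    simp only [e]

/-- A convergent sequence together with its limit is compact, so the closure adds only the limit,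
and no term of the sequence lies over the origin. -/
lemma tangents_range {w : ℕ → ℂ × ℂ} (h0 : ∀ m, w m ≠ 0) (hw : Tendsto w atTop (𝓝 0))
    {c : OnePoint ℂ} (hc : Tendsto (fun m => projSlope (w m)) atTop (𝓝 c)) :
    tangents (Set.range w) = {c} := by
  have ht : Tendsto (fun m => (w m, projSlope (w m))) atTop (𝓝 ((0 : ℂ × ℂ), c)) :=
    hw.prodMk_nhds hc
  have himg : (fun z => (z, projSlope z)) '' Set.range w =
      Set.range fun m => (w m, projSlope (w m)) := by
    rw [← Set.range_comp]; rfl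
  ext c'
  rw [tangents, Set.mem_ofPred_eq, himg, Set.mem_singleton_iff]
  constructor
  · intro h
    have h2 := closure_minimal (Set.subset_insert _ _) ht.isCompact_insert_range.isClosed h
    rcases h2 with h2 | ⟨m, hm⟩
    · exact congrArg Prod.snd h2
    · exact absurd (congrArg Prod.fst hm) (h0 m)
  · rintro rfl
    exact mem_closure_of_tendsto ht (Eventually.of_forall fun m => ⟨m, rfl⟩)

/-- The projective line is compact, and every cluster point of the slopes is a tangent of L. -/
lemma tendsto_projSlope {L : Set (ℂ × ℂ)} {c : OnePoint ℂ} (hL : tangents L = {c})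
    {w : ℕ → ℂ × ℂ} (hwL : ∀ᶠ m in atTop, w m ∈ L) (hw : Tendsto w atTop (𝓝 0)) :
    Tendsto (fun m => projSlope (w m)) atTop (𝓝 c) := by
  refine le_nhds_of_unique_clusterPt fun c' hc' => ?_
  have hmem : c' ∈ tangents L := by
    rw [tangents, Set.mem_ofPred_eq, mem_closure_iff_nhds]
    intro V hV
    rw [nhds_prod_eq, Filter.mem_prod_iff] at hV
    obtain ⟨A, hA, B, hB, hAB⟩ := hV
    have hf : ∃ᶠ m in atTop, projSlope (w m) ∈ B := (mapClusterPt_iff_frequently.1 hc') B hB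
    obtain ⟨m, hm, h1, h2⟩ := (hf.and_eventually ((hw.eventually_mem hA).and hwL)).exists
    exact ⟨(w m, projSlope (w m)), hAB ⟨h1, hm⟩, w m, h2, rfl⟩
  rw [hL] at hmem
  exact hmem

/-- A sequence with flat contact with the invariant curve is asymptotic to it. -/
lemma FormalCurve.IsParametrization.isAsymptotic {Γ : FormalCurve} {g : PowerSeries ℂ}
    (h : Γ.IsParametrization (PowerSeries.X, g)) {z : ℕ → ℂ × ℂ} (h0 : ∀ m, (z m).1 ≠ 0)
    (hz : Tendsto (fun m => (z m).1) atTop (𝓝 0))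
    (hc : ∀ n, Tendsto (fun m => ((z m).2 - (PowerSeries.trunc (n + 1) g).eval (z m).1) /
      (z m).1 ^ n) atTop (𝓝 0)) : Γ.IsAsymptotic (Set.range z) := by
  refine ⟨_, h.isInfinitelyNear, fun n => ?_⟩
  set w : ℕ → ℂ × ℂ := fun m =>
    ((z m).1, ((z m).2 - (PowerSeries.trunc (n + 1) g).eval (z m).1) / (z m).1 ^ n) with hw
  have hL : liftedSet (fun n => OnePoint.some (PowerSeries.coeff (n + 1) g)) (Set.range z) n =
      Set.range w := by
    ext v
    rw [mem_liftedSet_iff h.constantCoeff_graph]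
    constructor
    · rintro ⟨m, hm⟩
      have hm1 : (z m).1 = v.1 := (Prod.ext_iff.1 hm).1
      have hm2 : (z m).2 = v.1 ^ n * v.2 + (PowerSeries.trunc (n + 1) g).eval v.1 :=
        (Prod.ext_iff.1 hm).2
      refine ⟨m, Prod.ext hm1 ?_⟩
      have := h0 m
      rw [hm1] at this
      simp only [hw, hm1, hm2, add_sub_cancel_right]
      field_simp
    · rintro ⟨m, rfl⟩
      refine ⟨m, Prod.ext rfl ?_⟩
      have := h0 m
      simp only [hw]
      field_simp
      ring
  rw [hL]
  refine tangents_range (w := w) (fun m hm => h0 m (congrArg Prod.fst hm)) (Tendsto.prodMk_nhds hz (hc n) : Tendsto w atTop (𝓝 (0, 0))) ?_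
  have hslope : ∀ m, projSlope (w m) = OnePoint.some
      (((z m).2 - (PowerSeries.trunc (n + 1 + 1) g).eval (z m).1) / (z m).1 ^ (n + 1) +
        PowerSeries.coeff (n + 1) g) := by
    intro m
    have := h0 m
    have hw1 : (w m).1 ≠ 0 := h0 m
    rw [projSlope, if_neg hw1, eval_trunc_succ g (n + 1)]
    congr 1
    simp only [hw]
    field_simp
    ring
  simp only [hslope]
  refine (OnePoint.continuous_coe.tendsto _).comp ?_
  simpa using (hc (n + 1)).add_const (PowerSeries.coeff (n + 1) g)

/-- A finite first tangent excludes x = 0 eventually. Contact of order n makes the n-th lift tend to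
0; its slopes then converge to the coefficient n + 1 of g, which is contact of order n + 1. -/
lemma FormalCurve.IsParametrization.contact_of_isAsymptotic {Γ : FormalCurve} {g : PowerSeries ℂ}
    (h : Γ.IsParametrization (PowerSeries.X, g)) {z : ℕ → ℂ × ℂ}
    (hz : Tendsto z atTop (𝓝 0)) (ha : Γ.IsAsymptotic (Set.range z)) (n : ℕ) :
    (∀ᶠ m in atTop, (z m).1 ≠ 0) ∧
    Tendsto (fun m => ((z m).2 - (PowerSeries.trunc (n + 1) g).eval (z m).1) / (z m).1 ^ n)
      atTop (𝓝 0) := by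
  obtain ⟨q, hq, hit⟩ := ha
  obtain rfl : q = fun n => OnePoint.some (PowerSeries.coeff (n + 1) g) :=
    funext fun n => hq.eq h n
  have hz1 : Tendsto (fun m => (z m).1) atTop (𝓝 0) :=
    (continuous_fst.tendsto (0 : ℂ × ℂ)).comp hz
  have hz2 : Tendsto (fun m => (z m).2) atTop (𝓝 0) :=
    (continuous_snd.tendsto (0 : ℂ × ℂ)).comp hz
  have hne : ∀ᶠ m in atTop, (z m).1 ≠ 0 := by
    have h1 := tendsto_projSlope (hit 0) (w := z)
      (Eventually.of_forall fun m => ⟨m, rfl⟩) hz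
    filter_upwards [h1.eventually_ne (OnePoint.coe_ne_infty _)] with m hm h0
    exact hm (by rw [projSlope, if_pos h0])
  refine ⟨hne, ?_⟩
  induction n with
  | zero =>
    simpa [eval_trunc_succ, h.constantCoeff_graph] using hz2
  | succ n ih =>
    set w : ℕ → ℂ × ℂ := fun m =>
      ((z m).1, ((z m).2 - (PowerSeries.trunc (n + 1) g).eval (z m).1) / (z m).1 ^ n) with hw
    have h1 := tendsto_projSlope (hit n) (w := w) (by
      filter_upwards [hne] with m hm
      rw [mem_liftedSet_iff h.constantCoeff_graph]
      refine ⟨m, Prod.ext rfl ?_⟩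
      simp only [hw]
      field_simp
      ring) (hz1.prodMk_nhds ih)
    have h2 : Tendsto (fun m => (OnePoint.some (((z m).2 -
        (PowerSeries.trunc (n + 1) g).eval (z m).1) / (z m).1 ^ (n + 1)) : OnePoint ℂ)) atTop
        (𝓝 (OnePoint.some (PowerSeries.coeff (n + 1) g))) := by
      refine h1.congr' ?_
      filter_upwards [hne] with m hm
      have hw1 : (w m).1 ≠ 0 := hm
      rw [projSlope, if_neg hw1]
      congr 1
      simp only [hw]
      rw [div_div, pow_succ]
    have h3 := OnePoint.isOpenEmbedding_coe.isInducing.tendsto_nhds_iff.2 h2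
    have h4 := h3.sub_const (PowerSeries.coeff (n + 1) g)
    rw [sub_self] at h4
    refine h4.congr' ?_
    filter_upwards [hne] with m hm
    rw [eval_trunc_succ g (n + 1)]
    field_simp
    ring

end BlowUps

/-! ### Orbits in the node domain -/

section NodeDomain

lemma trunc_sub_trunc_isBigO (g : PowerSeries ℂ) {m n : ℕ} (h : m ≤ n) :
    (fun x => (PowerSeries.trunc n g - PowerSeries.trunc m g).eval x) =O[𝓝 0]
      fun x => ‖x‖ ^ m := by
  apply Polynomial.eval_isBigO_of_X_pow_dvd
  rw [Polynomial.X_pow_dvd_iff]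
  intro d hd
  rw [Polynomial.coeff_sub, PowerSeries.coeff_trunc, PowerSeries.coeff_trunc,
    if_pos (hd.trans_le h), if_pos hd, sub_self]

/-- Near the curve the term x^(r+1) y of the first component is thus O(x^(2r+1)), as the Fatou
coordinate requires. -/
lemma eventually_norm_snd_le {g : PowerSeries ℂ} {r : ℕ} (hg : ((r + 2 : ℕ) : ℕ∞) ≤ g.order)
    (n : ℕ) : ∀ᶠ x : ℂ in 𝓝 0, ∀ y : ℂ,
      ‖y - (PowerSeries.trunc n g).eval x‖ ≤ ‖x‖ ^ (r + 1) → ‖y‖ ≤ ‖x‖ ^ r := by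
  have hdvd : (Polynomial.X : Polynomial ℂ) ^ (r + 2) ∣ PowerSeries.trunc n g := by
    rw [Polynomial.X_pow_dvd_iff]
    intro d hd
    rw [PowerSeries.coeff_trunc, PowerSeries.coeff_of_lt_order, ite_self]
    exact lt_of_lt_of_le (by exact_mod_cast hd) hg
  obtain ⟨C, hC, h⟩ := exists_bound_of_isBigO (Polynomial.eval_isBigO_of_X_pow_dvd hdvd)
    (fun x => by positivity)
  filter_upwards [h, Metric.ball_mem_nhds (0 : ℂ) (show 0 < min 1 (1 / (C + 1)) by positivity)]
    with x hx hb y hy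
  have hb' : ‖x‖ < min 1 (1 / (C + 1)) := by simpa using hb
  have h1 := hb'.trans_le (min_le_left _ _)
  have h2 := hb'.trans_le (min_le_right _ _)
  rw [lt_div_iff₀ (by positivity)] at h2
  have e : y = (y - (PowerSeries.trunc n g).eval x) + (PowerSeries.trunc n g).eval x := by ring
  rw [e]
  have h3 : ‖x‖ ^ (r + 2) ≤ ‖x‖ ^ (r + 1) :=
    pow_le_pow_of_le_one (norm_nonneg _) h1.le (by omega)
  calc _ ≤ _ := norm_add_le _ _
    _ ≤ ‖x‖ ^ (r + 1) + C * ‖x‖ ^ (r + 1) := add_le_add hy (hx.trans (by gcongr))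
    _ = ‖x‖ ^ r * (‖x‖ * (C + 1)) := by ring
    _ ≤ ‖x‖ ^ r * 1 := by gcongr
    _ = _ := mul_one _

lemma IsReducedForm.fatou_bound {F : ℂ × ℂ → ℂ × ℂ} {Γ : FormalCurve} {k p : ℕ} {μ : ℂ}
    {a : Polynomial ℂ} (hred : IsReducedForm F Γ k p μ a) :
    ∃ C > 0, ∀ᶠ z : ℂ × ℂ in 𝓝 0, z.1 ≠ 0 → ‖z.2‖ ≤ ‖z.1‖ ^ (k + p) →
      ‖fatou (k + p) (F z).1 - fatou (k + p) z.1 - 1‖ ≤ C * ‖z.1‖ ^ (k + p) ∧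
      ‖(F z).1 - z.1‖ ≤ C * ‖z.1‖ ^ (k + p + 1) := by
  obtain ⟨C₀, hC₀, hb⟩ := hred.base_bound
  have hk := hred.one_le
  obtain ⟨C, hC, δ, hδ, h⟩ := fatou_step (k + p) (by omega) (show 0 < 2 * C₀ by positivity)
  refine ⟨C, hC, ?_⟩
  filter_upwards [hb, Metric.ball_mem_nhds (0 : ℂ × ℂ) hδ] with z hz hzδ hx hy
  have hzδ : ‖z‖ < δ := by simpa using hzδ
  refine h _ _ hx ((norm_fst_le z).trans_lt hzδ) (hz.trans ?_)
  calc _ ≤ C₀ * (‖z.1‖ ^ (k + p + 1) * ‖z.1‖ ^ (k + p) + ‖z.1‖ ^ (2 * (k + p) + 1)) := by gcongr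
    _ = _ := by ring

/-- The Fatou coordinate is 1/(r|x|^r) times (x/|x|)^(-r), and the latter factor tends to ξ^(-r) =
1. -/
lemma HasTangentDirection.tendsto_fatou_re {x : ℕ → ℂ} {ξ : ℂ} {r : ℕ} (hr : 1 ≤ r)
    (hξ : ξ ^ r = 1) (h : HasTangentDirection x ξ) :
    Tendsto (fun n => (fatou r (x n)).re) atTop atTop := by
  obtain ⟨h0, hne, hd⟩ := h
  have hr0 : (0 : ℝ) < r := by exact_mod_cast hr
  have h1 : Tendsto (fun n => (1 / (x n / (‖x n‖ : ℂ)) ^ r).re) atTop (𝓝 1) := by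
    have h2 := (hd.pow r).inv₀ (by rw [hξ]; exact one_ne_zero)
    rw [hξ] at h2
    have h3 := (Complex.continuous_re.tendsto _).comp h2
    simpa [Function.comp_def] using h3
  have h2 : Tendsto (fun n => r * ‖x n‖ ^ r) atTop (𝓝[>] 0) := by
    rw [tendsto_nhdsWithin_iff]
    constructor
    · have := (h0.norm.pow r).const_mul (r : ℝ)
      simpa [show r ≠ 0 by omega] using this
    · filter_upwards [hne] with n hn
      have := norm_pos_iff.2 hn
      exact Set.mem_Ioi.2 (by positivity)
  have h3 := h2.inv_tendsto_nhdsGT_zero.atTop_mul_pos one_pos h1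
  refine h3.congr' ?_
  filter_upwards [hne] with n hn
  have hn' : (‖x n‖ : ℂ) ≠ 0 := by exact_mod_cast (norm_pos_iff.2 hn).ne'
  have e : fatou r (x n) = (((r * ‖x n‖ ^ r)⁻¹ : ℝ) : ℂ) * (1 / (x n / (‖x n‖ : ℂ)) ^ r) := by
    rw [fatou, div_pow]
    push_cast
    field_simp
  rw [e, Complex.re_ofReal_mul]
  rfl

lemma HasTangentDirection.eventually_arg {x : ℕ → ℂ} {ξ : ℂ} {r : ℕ} (hr : 1 ≤ r)
    (hξ : ‖ξ‖ = 1) (h : HasTangentDirection x ξ) :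
    ∀ᶠ n in atTop, |(ξ⁻¹ * x n).arg| < Real.pi / (2 * r) := by
  obtain ⟨-, hne, hd⟩ := h
  have hξ0 : ξ ≠ 0 := by rintro rfl; simp at hξ
  obtain ⟨η, hη, hs⟩ := exists_sector r hr
  have h1 : Tendsto (fun n => ‖ξ⁻¹ * (x n / (‖x n‖ : ℂ)) - 1‖) atTop (𝓝 0) := by
    have := ((hd.const_mul ξ⁻¹).sub_const 1).norm
    rwa [inv_mul_cancel₀ hξ0, sub_self, norm_zero] at this
  filter_upwards [hne, h1.eventually (gt_mem_nhds hη)] with n hn hlt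
  refine hs _ (mul_ne_zero (inv_ne_zero hξ0) hn) ?_
  have hnp := norm_pos_iff.2 hn
  have hn' : (‖x n‖ : ℂ) ≠ 0 := by exact_mod_cast hnp.ne'
  have hw : ‖ξ⁻¹ * x n‖ = ‖x n‖ := by rw [norm_mul, norm_inv, hξ, inv_one, one_mul]
  rw [hw]
  have e : ξ⁻¹ * x n - ‖x n‖ = (ξ⁻¹ * (x n / (‖x n‖ : ℂ)) - 1) * ‖x n‖ := by
    field_simp
  rw [e, norm_mul, Complex.norm_real, norm_norm]
  gcongr

lemma nodeDomain_isOpen {R : Set ℂ} (hR : IsOpen R) (g : PowerSeries ℂ) (M q : ℕ) :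
    IsOpen (nodeDomain R g M q) := by
  have h1 : IsOpen {z : ℂ × ℂ | z.1 ∈ R} := hR.preimage continuous_fst
  have := (PowerSeries.trunc (M + 1) g).continuous
  exact h1.inter (isOpen_lt (f := fun z : ℂ × ℂ => ‖z.2 - (PowerSeries.trunc (M + 1) g).eval z.1‖)
    (g := fun z : ℂ × ℂ => ‖z.1‖ ^ q) (by fun_prop) (by fun_prop))

/-- Orbits in a petal that stay close to the invariant curve have flat contact with it. -/
lemma tendsto_contact {F : ℂ × ℂ → ℂ × ℂ} {Γ : FormalCurve} {k p : ℕ} {μ : ℂ}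
    {a : Polynomial ℂ} {g : PowerSeries ℂ} {ξ : ℂ} (hF0 : F 0 = 0) (hF : AnalyticAt ℂ F 0)
    (hΓ : Γ.IsInvariant F) (hred : IsReducedForm F Γ k p μ a)
    (h : Γ.IsParametrization (PowerSeries.X, g)) (hξ : ‖ξ‖ = 1)
    (hnode : IsNodeDirection k p μ a ξ) {C : ℝ} (hC : 0 < C) {z : ℕ → ℂ × ℂ}
    (hz : ∀ m, z (m + 1) = F (z m)) (hz0 : Tendsto z atTop (𝓝 0)) (hne : ∀ m, (z m).1 ≠ 0)
    (hang : ∀ m, ‖ξ⁻¹ * (z m).1 - ‖(z m).1‖‖ ≤ ‖(z m).1‖ ^ (p + 1))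
    (hd : ∀ m, ‖(F (z m)).1 - (z m).1‖ ≤ C * ‖(z m).1‖ ^ (k + p + 1)) (n : ℕ) :
    Tendsto (fun m => ((z m).2 - (PowerSeries.trunc (n + 1) g).eval (z m).1) / (z m).1 ^ n)
      atTop (𝓝 0) := by
  have hz1 : Tendsto (fun m => (z m).1) atTop (𝓝 0) :=
    (continuous_fst.tendsto (0 : ℂ × ℂ)).comp hz0
  obtain ⟨N, hN⟩ := eventually_atTop.1 (hz0.eventually
    (transverse_step hF0 hF hΓ hred h hξ hnode hC (n + 1)))
  set J := PowerSeries.trunc (n + 1 + (k + p) + 1) g with hJ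
  -- W accommodates the height at the time N when the orbit enters the neighbourhood of validity.
  -- The exponent n + 1 leaves a factor |x| to spare after division by x^n.
  set W := max 1 (‖(z N).2 - J.eval (z N).1‖ / ‖(z N).1‖ ^ (n + 1)) with hW
  have hbd : ∀ m ≥ N, ‖(z m).2 - J.eval (z m).1‖ ≤ W * ‖(z m).1‖ ^ (n + 1) := by
    intro m hm
    induction m, hm using Nat.le_induction with
    | base =>
      have := norm_pos_iff.2 (hne N)
      rw [← div_le_iff₀ (by positivity)]
      exact le_max_right _ _
    | succ m hm ih =>
      rw [hz m]
      exact (hN m hm (hne m) (hang m) (hd m) W (le_max_left _ _) ih).le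
  obtain ⟨D, hD, hT⟩ := exists_bound_of_isBigO (trunc_sub_trunc_isBigO g
    (show n + 1 ≤ n + 1 + (k + p) + 1 by omega)) (fun x => by positivity)
  refine squeeze_zero_norm' (a := fun m => (W + D) * ‖(z m).1‖) ?_ ?_
  · filter_upwards [eventually_ge_atTop N, hz1.eventually hT] with m hm hT
    have hp := norm_pos_iff.2 (hne m)
    rw [norm_div, norm_pow, div_le_iff₀ (by positivity)]
    have e : (z m).2 - (PowerSeries.trunc (n + 1) g).eval (z m).1 =
        ((z m).2 - J.eval (z m).1) + (J - PowerSeries.trunc (n + 1) g).eval (z m).1 := by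
      rw [Polynomial.eval_sub]; ring
    rw [e]
    calc _ ≤ _ := norm_add_le _ _
      _ ≤ W * ‖(z m).1‖ ^ (n + 1) + D * ‖(z m).1‖ ^ (n + 1) := add_le_add (hbd m hm) hT
      _ = _ := by ring
  · simpa using hz1.norm.const_mul (W + D)

end NodeDomain

/-! ### The stable manifold -/

theorem mainTheorem7
    (F : ℂ × ℂ → ℂ × ℂ) (hF : IsGermDiffeo F)
    (Γ : FormalCurve) (hΓ : Γ.IsInvariant F)
    (k p : ℕ) (μ : ℂ) (a : Polynomial ℂ) (hred : IsReducedForm F Γ k p μ a)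
    (γ₂ : PowerSeries ℂ) (hγ : Γ.IsParametrization (PowerSeries.X, γ₂))
    (ξ : ℂ) (hξ : ξ ^ (k + p) = 1) (hnode : IsNodeDirection k p μ a ξ)
    (U : Set (ℂ × ℂ)) (hU : IsOpen U) (h0U : (0 : ℂ × ℂ) ∈ U) (hFU : AnalyticOnNhd ℂ F U) :
    ∃ (R : Set ℂ) (M q : ℕ),
      IsOpen R ∧ IsConnected R ∧ IsSimplyConnected R ∧ (0 : ℂ) ∈ frontier R ∧
      (∃ δ : ℝ, 0 < δ ∧ ∀ t : ℝ, 0 < t → t < δ → ξ * (t : ℂ) ∈ R) ∧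
      k + p + 2 ≤ M ∧ p + 1 ≤ q ∧
      IsOpenStableManifold F U (nodeDomain R γ₂ M q) ∧
      (∀ w ∈ nodeDomain R γ₂ M q, IsAsymptoticOrbit F U Γ (fun n => F^[n] w)) ∧
      (∀ z : ℕ → ℂ × ℂ, IsAsymptoticOrbit F U Γ z →
        HasTangentDirection (fun n => (z n).1) ξ →
        ∀ᶠ n in atTop, z n ∈ nodeDomain R γ₂ M q) := by
  have hk := hred.one_le
  have hr : 1 ≤ k + p := by omega
  have hξn : ‖ξ‖ = 1 := Complex.norm_eq_one_of_pow_eq_one hξ (by omega)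
  have horder : ((k + p + 2 : ℕ) : ℕ∞) ≤ γ₂.order := by
    obtain ⟨g, hg, ho⟩ := hred.contact
    rwa [hγ.snd_unique hg] at ho
  obtain ⟨C, hC, hbase⟩ := hred.fatou_bound
  -- The choice q = k + p + 1 forces |y| ≤ |x|^(k+p) on S; the jet order M = q + (k + p) is the one
  -- matched to q.
  have htrans := transverse_step hF.map_zero hF.analyticAt hΓ hred hγ hξn hnode hC (k + p + 1)
  have hjet := eventually_norm_snd_le horder (k + p + 1 + (k + p) + 1)
  obtain ⟨ρ, hρ, hball⟩ := Metric.eventually_nhds_iff_ball.1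
    ((hbase.and htrans).and (hU.eventually_mem h0U))
  obtain ⟨σ, hσ, hjetσ⟩ := Metric.eventually_nhds_iff_ball.1 hjet
  set ε := min 1 (min ρ σ) with hε
  have hε0 : 0 < ε := by positivity
  -- Invariance of the petal needs B ≥ 4C, absorption of tangent orbits B > 4C.
  set B := 8 * C with hB
  have hB0 : 0 < B := by positivity
  obtain ⟨K, ⟨hsmall, hstep⟩, hK⟩ := (((petal_small (p := p) hr (by omega) hξ hB0 hε0).and
    (petal_step hr hξ hC (show 4 * C ≤ B by linarith))).and (eventually_ge_atTop 1)).exists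
  set R := petal (k + p) ξ K B with hR
  set S := nodeDomain R γ₂ (k + p + 1 + (k + p)) (k + p + 1) with hS
  have hpt : ∀ z ∈ S, z ∈ Metric.ball (0 : ℂ × ℂ) ρ ∧ ‖z.1‖ < 1 ∧ ‖z.2‖ ≤ ‖z.1‖ ^ (k + p) := by
    rintro z ⟨hzR, hzJ⟩
    have h1 := (hsmall _ hzR).1
    have h1' : ‖z.1‖ < 1 := h1.trans_le (min_le_left _ _)
    have h2 : ‖z.2‖ ≤ ‖z.1‖ ^ (k + p) := by
      refine hjetσ z.1 ?_ z.2 hzJ.le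
      rw [mem_ball_zero_iff]
      exact h1.trans_le ((min_le_right _ _).trans (min_le_right _ _))
    refine ⟨?_, h1', h2⟩
    have h3 : ‖z.2‖ ≤ ‖z.1‖ := by
      calc _ ≤ _ := h2
        _ ≤ ‖z.1‖ ^ 1 := pow_le_pow_of_le_one (norm_nonneg _) h1'.le hr
        _ = _ := pow_one _
    rw [mem_ball_zero_iff, Prod.norm_def, max_eq_left h3]
    exact h1.trans_le ((min_le_right _ _).trans (min_le_left _ _))
  have hmove : ∀ z ∈ S, ‖(F z).1 - z.1‖ ≤ C * ‖z.1‖ ^ (k + p + 1) ∧ F z ∈ S ∧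
      (fatou (k + p) z.1).re + 1 / 2 ≤ (fatou (k + p) (F z).1).re := by
    intro z hz
    obtain ⟨hzρ, -, hy⟩ := hpt z hz
    obtain ⟨⟨hb, ht⟩, -⟩ := hball z hzρ
    have hx0 : z.1 ≠ 0 := hz.1.1
    obtain ⟨b1, b2⟩ := hb hx0 hy
    obtain ⟨s1, s2⟩ := hstep _ hz.1 _ b1 b2
    have t1 := ht hx0 (hsmall _ hz.1).2.2 b2 1 le_rfl (by rw [one_mul]; exact hz.2.le)
    rw [one_mul] at t1
    exact ⟨b2, ⟨s1, t1⟩, s2⟩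
  have hmaps : Set.MapsTo F S S := fun z hz => (hmove z hz).2.1
  have hiter : ∀ z ∈ S, ∀ n, F^[n] z ∈ S := fun z hz n => hmaps.iterate n hz
  have hre : ∀ z ∈ S, ∀ n : ℕ, (n : ℝ) / 2 < (fatou (k + p) (F^[n] z).1).re := by
    intro z hz n
    induction n with
    | zero =>
      have := hz.1.2.2.1
      simp only [Nat.cast_zero, zero_div, Function.iterate_zero, id]
      linarith
    | succ n ih =>
      rw [Function.iterate_succ_apply']
      have := (hmove _ (hiter z hz n)).2.2
      push_cast
      linarith
  have htend : ∀ z ∈ S, Tendsto (fun n => F^[n] z) atTop (𝓝 0) := by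
    intro z hz
    have hpow : Tendsto (fun n => ‖(F^[n] z).1‖ ^ (k + p)) atTop (𝓝 0) := by
      have hX : Tendsto (fun n => (fatou (k + p) (F^[n] z).1).re) atTop atTop :=
        tendsto_atTop_mono (fun n => (hre z hz n).le)
          (tendsto_natCast_atTop_atTop.atTop_div_const two_pos)
      refine squeeze_zero (fun n => by positivity) (fun n => ?_) (hX.const_div_atTop 1)
      exact norm_pow_le_inv_re hr ((by positivity : (0 : ℝ) ≤ (n : ℝ) / 2).trans_lt (hre z hz n))
    have hx : Tendsto (fun n => (F^[n] z).1) atTop (𝓝 0) := by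
      rw [Metric.tendsto_nhds]
      intro e he
      filter_upwards [hpow.eventually (gt_mem_nhds (pow_pos he (k + p)))] with n hn
      rw [dist_zero_right]
      exact lt_of_pow_lt_pow_left₀ _ he.le hn
    have hy : Tendsto (fun n => (F^[n] z).2) atTop (𝓝 0) :=
      squeeze_zero_norm (fun n => (hpt _ (hiter z hz n)).2.2) hpow
    exact hx.prodMk_nhds hy
  have hSU : S ⊆ U := fun z hz => (hball z (hpt z hz).1).2
  have hsc := petal_isSimplyConnected hr hξ hK hB0
  refine ⟨R, k + p + 1 + (k + p), k + p + 1, petal_isOpen hr hξ hK, hsc.isPathConnected.isConnected,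
    hsc, zero_mem_frontier_petal hr hξ hK hB0, ray_mem_petal hr hξ hK hB0, by omega, by omega,
    ⟨⟨hSU, hmaps, htend⟩, nodeDomain_isOpen (petal_isOpen hr hξ hK) _ _ _⟩, ?_, ?_⟩
  · intro w hw
    have hne : ∀ n, (F^[n] w).1 ≠ 0 := fun n => (hiter w hw n).1.1
    refine ⟨fun n => hSU (hiter w hw n), fun n h0 => hne n (congrArg Prod.fst h0),
      fun n => Function.iterate_succ_apply' F n w, htend w hw, ?_⟩
    refine hγ.isAsymptotic hne ((continuous_fst.tendsto (0 : ℂ × ℂ)).comp (htend w hw)) ?_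
    exact tendsto_contact hF.map_zero hF.analyticAt hΓ hred hγ hξn hnode hC
      (fun n => Function.iterate_succ_apply' F n w) (htend w hw) hne
      (fun n => (hsmall _ (hiter w hw n).1).2.2) (fun n => (hmove _ (hiter w hw n)).1)
  · intro z hz hdir
    have hz1 := hdir.1
    -- Contact of order M gives |y - J(x)| < |x|^M ≤ |x|^q eventually.
    obtain ⟨hne, hc⟩ := hγ.contact_of_isAsymptotic hz.tendsto hz.asymptotic (k + p + 1 + (k + p))
    have hlt1 : ∀ᶠ n in atTop, ‖(z n).1‖ < 1 := hz1.norm.eventually (gt_mem_nhds (by rw [norm_zero]; exact one_pos))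
    have hclose : ∀ᶠ n in atTop,
        ‖(z n).2 - (PowerSeries.trunc (k + p + 1 + (k + p) + 1) γ₂).eval (z n).1‖ <
          ‖(z n).1‖ ^ (k + p + 1) := by
      filter_upwards [hne, hlt1, hc.norm.eventually 
        (gt_mem_nhds (show ‖(0 : ℂ)‖ < 1 by rw [norm_zero]; exact one_pos))] with n h1 h2 h3
      have hp := norm_pos_iff.2 h1
      rw [norm_div, norm_pow, div_lt_one (by positivity)] at h3
      exact h3.trans_le (pow_le_pow_of_le_one hp.le h2.le (by omega))
    have hreT := hdir.tendsto_fatou_re hr hξ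
    have hlog : ∀ᶠ n in atTop, fatou (k + p) (z n).1 ∈ logRegion K B := by
      refine eventually_mem_logRegion hC (by linarith) hreT ?_
      filter_upwards [hne, hclose, hz1.eventually hjet, hz.tendsto.eventually hbase,
        hreT.eventually_gt_atTop 0] with n h1 h2 h3 h4 h5
      rw [hz.step n]
      refine (h4 h1 (h3 _ h2.le)).1.trans ?_
      rw [div_eq_mul_one_div]
      exact mul_le_mul_of_nonneg_left (norm_pow_le_inv_re hr h5) hC.le
    filter_upwards [hne, hclose, hlog, hdir.eventually_arg hr hξn] with n h1 h2 h3 h4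
    exact ⟨⟨h1, h4, h3⟩, h2⟩

end
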